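/- A *quadriculated annulus* $A$ is a closed oriented topological annulus obtained by gluing finitely many squares along sides, so that every interior vertex is surrounded by exactly four squares. Assume that its squares are coloured black and white, squares sharing a side having different colours, with equally many squares of each colour. Let $G_A$ be the graph whose vertices are the squares and whose edges are the pairs of glued sides (so a domino tiling of $A$ is a perfect matching of $G_A$), and let $T_A$ be the set of domino tilings of $A$. Choose a cut $\xi$ of $A$ (a simple path of sides joining the two boundary circles, with only its endpoints on the boundary), a maximal tree in the graph $G_\Delta\subset G_A$ of edges not crossing $\xi$, and an edge of $G_A$ crossing $\xi$. The Kasteleyn weights are the signed monomials $\pm p^a q^b$ ($a,b\in\mathbb Z$) on the edges of $G_A$ determined by the following requirements: the edges of the tree have weight $1$, the chosen crossing edge has weight $p$, and, for the four edges around any interior vertex, $w_2w_3=-q\,w_0w_1$ whenever a positive flip takes the dominoes $e_0,e_1$ to $e_2,e_3$. Here a flip replaces two dominoes filling the $2\times2$ square around an interior vertex by the other two; it is positive if the two sides from the central vertex not crossed by the original dominoes point away from that vertex, when sides are oriented counterclockwise along the boundary of white squares (and clockwise along that of black ones). For $t\in T_A$, let $\pm p^{\phi(t)}q^{\nu(t)}$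 be the product of the weights of its dominoes; $\phi(t)$ is the flux and $\nu(t)$ the volume of $t$. The $q$-flux polynomial of $A$ is $$\Phi_A(p,q)=\sum_{t\in T_A}p^{\phi(t)}q^{\nu(t)} .$$ **Corollary.** Let $q$ be a fixed positive real number, and for $f\in\mathbb Z$ let $a_f$ be the coefficient of $p^f$ in $\Phi_A(p,q)$. Then the sequence $(a_f)_{f\in\mathbb Z}$ is log-concave: $a_f\ge 0$ and $a_f^2\ge a_{f-1}a_{f+1}$ for all $f\in\mathbb Z$. Moreover it is unimodal: there is an $m\in\mathbb Z$ such that $a_f$ is nondecreasing for $f\le m$ and nonincreasing for $f\ge m$ (so, restricted to the range of fluxes that occur, it is monotone or unimodal). -/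

import Mathlib

/-- A compact oriented quadriculated surface, given by gluing finitely many squares along sides.
Each square `s : S` has four sides `(s, 0), (s, 1), (s, 2), (s, 3)`, listed counterclockwise.
`glue x` is the side glued to `x` (with reversed direction, so that the surface is oriented);
`glue x = x` means that `x` is not glued and lies on the boundary of the surface. -/
structure QuadSurface (S : Type*) where
  glue : S × ZMod 4 → S × ZMod 4
  glue_glue : ∀ x, glue (glue x) = x

namespace QuadSurface

variable {S : Type*} (A : QuadSurface S)

/-- The side that follows `x` counterclockwise in the same square. It starts where `x` ends. -/
def next (x : S × ZMod 4) : S × ZMod 4 := (x.1, x.2 + 1)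

/-- `x` is a boundary side. -/
def IsBoundarySide (x : S × ZMod 4) : Prop := A.glue x = x

/-- A side `x` also stands for the corner of its square at which `x` starts. For a glued side `x`,
`rot x` is the next corner (clockwise) around the same vertex: `glue x` runs in the opposite
direction and ends where `x` starts. -/
def rot (x : S × ZMod 4) : S × ZMod 4 := next (A.glue x)

/-- The vertices of the surface: classes of corners identified by the gluing of sides. -/
def Vertex : Type _ :=
  Quot (fun x y : S × ZMod 4 => ¬ A.IsBoundarySide x ∧ y = A.rot x)

/-- The starting vertex of the side `x` (and the vertex at the corner `x`). -/
def src (x : S × ZMod 4) : A.Vertex := Quot.mk _ x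

/-- The final vertex of the side `x`. -/
def tgt (x : S × ZMod 4) : A.Vertex := A.src (next x)

/-- The edges of the cell decomposition: sides, up to the gluing. -/
def Edge : Type _ := Quot (fun x y : S × ZMod 4 => y = A.glue x)

/-- A vertex is interior if no boundary side starts at it (going around a boundary vertex
clockwise one always ends with a boundary side that starts there). -/
def IsInteriorVertex (v : A.Vertex) : Prop := ∀ x, A.src x = v → ¬ A.IsBoundarySide x

/-- The squares are connected through the sides in `E`. -/
def ConnectedThrough (E : Set (S × ZMod 4)) : Prop :=
  ∀ s t : S, Relation.ReflTransGen
    (fun a b => ∃ i, (a, i) ∈ E ∧ (A.glue (a, i)).1 = b) s t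

/-- The Euler characteristic. -/
noncomputable def eulerChar : ℤ :=
  (Nat.card A.Vertex : ℤ) - (Nat.card A.Edge : ℤ) + (Nat.card S : ℤ)

/-- A quadriculated annulus: a quadriculated surface, with exactly four squares around each
interior vertex, which is topologically an annulus. By the classification of surfaces, a compact
oriented surface is an annulus if and only if it is connected, has nonempty boundary and has
Euler characteristic `0`. -/
structure IsAnnulus : Prop where
  flat : ∀ v : A.Vertex, A.IsInteriorVertex v → Nat.card {x : S × ZMod 4 // A.src x = v} = 4
  connected : A.ConnectedThrough Set.univ
  boundary_nonempty : ∃ x, A.IsBoundarySide x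
  eulerChar_eq_zero : A.eulerChar = 0

/-- `white` is the set of white squares of a balanced checkerboard colouring. -/
structure IsBalancedBicoloring [Fintype S] [DecidableEq S] (white : Finset S) : Prop where
  alternating : ∀ x, ¬ A.IsBoundarySide x → (x.1 ∈ white ↔ (A.glue x).1 ∉ white)
  balanced : white.card = whiteᶜ.card

/-- A cut: a simple path of sides which joins two boundary vertices, has only interior vertices in
between, and opens the annulus: the squares remain connected when the sides of the path are
unglued (so the path joins the two boundary circles). -/
structure Cut where
  len : ℕ
  side : Fin (len + 1) → S × ZMod 4
  point : Fin (len + 2) → A.Vertex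
  src_side : ∀ i, A.src (side i) = point i.castSucc
  tgt_side : ∀ i, A.tgt (side i) = point i.succ
  point_injective : Function.Injective point
  not_boundarySide : ∀ i, ¬ A.IsBoundarySide (side i)
  interior_iff : ∀ i, A.IsInteriorVertex (point i) ↔ i ≠ 0 ∧ i ≠ Fin.last (len + 1)
  opens : A.ConnectedThrough {x | ∀ i, x ≠ side i ∧ x ≠ A.glue (side i)}

variable {A} in
/-- The sides lying on the cut. An edge of the graph `G_A` (whose vertices are the squares and
whose edges are the glued sides) crosses the cut if its side lies on the cut. -/
def Cut.sides (ξ : A.Cut) : Set (S × ZMod 4) := {x | ∃ i, x = ξ.side i ∨ x = A.glue (ξ.side i)}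

/-- `T` is (the set of sides crossed by the edges of) a maximal tree in the graph `G_Δ`, where `Δ`
is obtained by opening the annulus along `ξ`: a set of glued sides not on the cut which connects
all squares with `|S| - 1` edges. Each edge is counted twice, once from each of its squares. -/
structure IsMaximalTree (ξ : A.Cut) (T : Set (S × ZMod 4)) : Prop where
  glue_mem : ∀ x ∈ T, A.glue x ∈ T
  not_boundarySide : ∀ x ∈ T, ¬ A.IsBoundarySide x
  not_mem_cut : ∀ x ∈ T, x ∉ ξ.sides
  connected : A.ConnectedThrough T
  card_eq : Nat.card T + 2 = 2 * Nat.card S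

end QuadSurface

/-- Signed Laurent monomials `± p ^ a * q ^ b`, as a multiplicative group; the entries are the
sign, the exponent of `p` and the exponent of `q`. -/
abbrev SignedMonomial : Type := ℤˣ × Multiplicative ℤ × Multiplicative ℤ

namespace SignedMonomial

/-- The monomial `p`. -/
def p : SignedMonomial := (1, Multiplicative.ofAdd 1, 1)

/-- The monomial `-q`. -/
def negq : SignedMonomial := (-1, 1, Multiplicative.ofAdd 1)

/-- The exponent of `p`. -/
def expP (m : SignedMonomial) : ℤ := Multiplicative.toAdd m.2.1

/-- The exponent of `q`. -/
def expQ (m : SignedMonomial) : ℤ := Multiplicative.toAdd m.2.2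

end SignedMonomial

namespace QuadSurface

variable {S : Type*} (A : QuadSurface S)

/-- `w` gives the Kasteleyn weights of the edges of `G_A` determined by the cut `ξ`, the maximal
tree `T` of `G_Δ` and the edge `e` crossing the cut; an edge of `G_A` is a glued side `x`, also
called `glue x`. The edges of `T` have weight `1`, `e` has weight `p`, and around each interior
vertex the requirement `w₂ w₃ = -q w₀ w₁` holds, where a positive flip takes the edges `e₀, e₁`
to `e₂, e₃`. If `x` is a corner of a white square, then the sides `x` and `rot (rot x)`, directed
counterclockwise along the boundaries of their white squares, point away from the vertex, so the
positive flip starts with the two dominoes that do not cross them, and ends with the two dominoes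
that do. -/
structure IsKasteleynWeight (white : Finset S) (ξ : A.Cut) (T : Set (S × ZMod 4))
    (e : S × ZMod 4) (w : S × ZMod 4 → SignedMonomial) : Prop where
  glue_eq : ∀ x, w (A.glue x) = w x
  tree_eq : ∀ x ∈ T, w x = 1
  edge_eq : w e = SignedMonomial.p
  flip_eq : ∀ x, A.IsInteriorVertex (A.src x) → x.1 ∈ white →
    w x * w (A.rot (A.rot x)) =
      SignedMonomial.negq * (w (A.rot x) * w (A.rot (A.rot (A.rot x))))

/-- A domino tiling, given by the function which maps each square `s` to the side of `s` crossed
by the domino covering `s`: this side is glued, and it is also the side chosen by the other square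
of the domino. -/
def IsTiling (t : S → ZMod 4) : Prop :=
  ∀ s, ¬ A.IsBoundarySide (s, t s) ∧
    t (A.glue (s, t s)).1 = (A.glue (s, t s)).2

open Classical in
/-- The set of domino tilings. -/
noncomputable def tilings [Fintype S] : Finset (S → ZMod 4) :=
  Finset.univ.filter A.IsTiling

/-- The product of the weights of the dominoes of a tiling; each domino has one white square. -/
def tilingWeight (white : Finset S) (w : S × ZMod 4 → SignedMonomial) (t : S → ZMod 4) :
    SignedMonomial :=
  ∏ s ∈ white, w (s, t s)

/-- The flux of a tiling: the exponent of `p` in its weight. -/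
def flux (white : Finset S) (w : S × ZMod 4 → SignedMonomial) (t : S → ZMod 4) : ℤ :=
  (tilingWeight white w t).expP

/-- The volume of a tiling: the exponent of `q` in its weight. -/
def volume (white : Finset S) (w : S × ZMod 4 → SignedMonomial) (t : S → ZMod 4) : ℤ :=
  (tilingWeight white w t).expQ

/-- The `q`-flux polynomial `∑ p ^ flux t * q ^ volume t` (sum over all tilings `t`), as a Laurent
polynomial in `p` for a fixed real value of `q`. -/
noncomputable def qFluxPolynomial [Fintype S] (white : Finset S)
    (w : S × ZMod 4 → SignedMonomial) (q : ℝ) : LaurentPolynomial ℝ :=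
  ∑ t ∈ A.tilings,
    LaurentPolynomial.C (q ^ volume white w t) * LaurentPolynomial.T (flux white w t)

end QuadSurface

/-- A sequence of nonnegative real numbers with `a k ^ 2 ≥ a (k - 1) * a (k + 1)` for all `k`. -/
def IsLogConcaveSeq (a : ℤ → ℝ) : Prop :=
  (∀ k, 0 ≤ a k) ∧ ∀ k, a (k - 1) * a (k + 1) ≤ a k ^ 2

/-- The sequence increases (weakly) up to some index and decreases (weakly) from there on. -/
def IsUnimodalSeq (a : ℤ → ℝ) : Prop :=
  ∃ m : ℤ, MonotoneOn a (Set.Iic m) ∧ AntitoneOn a (Set.Ici m)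

/-!
The coefficient of `p ^ f` is the sum of `q ^ volume t` over the tilings `t` of flux `f`. Two tilings
`t₁` and `t₂` of fluxes `f - 1` and `f + 1` are superposed: their dominoes form disjoint simple
closed curves of squares (and common dominoes), the components of the superposition. Exchanging the
dominoes of `t₁` and `t₂` in a set of components gives two tilings with the same total volume, and
every component contributes `-1`, `0` or `1` to the difference of the fluxes
(`IsKasteleynWeight.abs_fluxDiff_le`). If the components are listed in an order that depends only on
the union of the two tilings, then there is a first initial part of the list whose contribution is
`1`. Exchanging the dominoes outside it gives two tilings of flux `f`. The new pair has the same
first initial part, so this map is injective (`exchange_exchange`), which gives log-concavity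
(`IsKasteleynWeight.coeff_mul_coeff_le`). In the same way all fluxes between two that occur also
occur (`IsKasteleynWeight.exists_isTiling_flux_eq`). Hence there are no internal zeros, and the
sequence is unimodal.

That a component contributes at most one says that a simple closed curve goes around the annulus at
most once. This is proved through cohomology. Let a permutation rotate the corners around each
interior vertex and, passing from one boundary vertex to the next, along each boundary circle. Its
cycles are the vertices of the closed surface obtained by collapsing the boundary circles. Parity of
signs of permutations shows that the number of boundary circles is even, and a dimension count shows
that there are at most two. So there are exactly two, and the count then says that each cocycle
relative to the boundary is the coboundary of a function (a potential) on these cycles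
(`IsAnnulus.range_coboundary`). The `p`-exponents of the Kasteleyn weights form a relative
cycle, so the flux of a cocycle is proportional to the difference of the values of its potential on
the two boundary circles. The closed path formed by `e` and the tree has flux `±1` and an integer
difference, so the factor has absolute value at most `1` (`IsAnnulus.abs_sum_mul_le`). Finally, the
potential of a simple closed curve takes at most two values, which differ by `1`
(`IsAnnulus.abs_potential_sub_le`).
-/


/-! ### Cycles of permutations -/

namespace Equiv.Perm

variable {X : Type*}

/-- The set of cycles of a permutation, fixed points included. -/
abbrev Cycles (σ : Perm X) : Type _ := Quotient (SameCycle.setoid σ)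

theorem card_quot_eq_of_kernel {α β : Type*} {r : α → α → Prop} (f : α → β)
    (hr : ∀ a b, r a b → f a = f b)
    (hf : ∀ a b, f a = f b → Quot.mk r a = Quot.mk r b) (hs : Function.Surjective f) :
    Nat.card (Quot r) = Nat.card β := by
  refine Nat.card_congr (Equiv.ofBijective (Quot.lift f hr) ⟨?_, ?_⟩)
  · rintro ⟨a⟩ ⟨b⟩ h
    exact hf a b h
  · intro y
    obtain ⟨a, rfl⟩ := hs y
    exact ⟨Quot.mk r a, rfl⟩

theorem quot_mk_eq_pow {σ : Perm X} {D : X → Prop} (x : X) (n : ℕ)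
    (h : ∀ i < n, ¬ D ((σ ^ i) x)) :
    Quot.mk (fun x y => ¬ D x ∧ y = σ x) x = Quot.mk _ ((σ ^ n) x) := by
  induction n with
  | zero => rfl
  | succ n ih =>
    rw [ih fun i hi => h i (hi.trans (Nat.lt_succ_self n))]
    exact Quot.sound ⟨h n (Nat.lt_succ_self n), by rw [pow_succ', mul_apply]⟩

/-- If each cycle of `σ` is cut open after each of its points in `D`, then a cycle that meets `D`
falls into as many pieces as it has points in `D`. -/
theorem card_quot_add_card_cycles [Finite X] (σ : Perm X) (D : X → Prop) :
    Nat.card (Quot fun x y => ¬ D x ∧ y = σ x) +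
        Nat.card {q : σ.Cycles // ∃ x, D x ∧ (⟦x⟧ : σ.Cycles) = q} =
      Nat.card σ.Cycles + Nat.card {x // D x} := by
  classical
  -- A point is sent to the first point of `D` met when `σ` is iterated, if there is one.
  let f : X → {q : σ.Cycles // ¬ ∃ x, D x ∧ (⟦x⟧ : σ.Cycles) = q} ⊕ {x // D x} := fun x =>
    if h : ∃ n : ℕ, D ((σ ^ n) x) then Sum.inr ⟨(σ ^ Nat.find h) x, Nat.find_spec h⟩
    else Sum.inl ⟨⟦x⟧, by
      rintro ⟨y, hy, hyx⟩
      obtain ⟨n, hn⟩ := (Quotient.exact hyx : σ.SameCycle y x).symm.exists_nat_pow_eq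
      exact h ⟨n, hn ▸ hy⟩⟩
  have hcard : Nat.card (Quot fun x y => ¬ D x ∧ y = σ x) =
      Nat.card ({q : σ.Cycles // ¬ ∃ x, D x ∧ (⟦x⟧ : σ.Cycles) = q} ⊕ {x // D x}) := by
    refine card_quot_eq_of_kernel f ?_ ?_ ?_
    · rintro x _ ⟨hx, rfl⟩
      have key : ∀ n : ℕ, (σ ^ n) (σ x) = (σ ^ (n + 1)) x := fun n => by
        rw [pow_succ, mul_apply]
      by_cases h : ∃ n : ℕ, D ((σ ^ n) x)
      · have h' : ∃ n : ℕ, D ((σ ^ (n + 1)) x) := by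
          obtain ⟨n, hn⟩ := h
          cases n with
          | zero => exact absurd hn hx
          | succ n => exact ⟨n, hn⟩
        have h'' : ∃ n : ℕ, D ((σ ^ n) (σ x)) := by simpa only [key] using h'
        have hfind : Nat.find h = Nat.find h'' + 1 := by
          rw [Nat.find_comp_succ h h' hx]
          congr 1
        simp only [f, dif_pos h, dif_pos h'', hfind, key]
      · have h'' : ¬ ∃ n : ℕ, D ((σ ^ n) (σ x)) := by
          rintro ⟨n, hn⟩
          exact h ⟨n + 1, by rwa [← key]⟩
        simp only [f, dif_neg h, dif_neg h'']
        congr 2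
        exact Quotient.sound (sameCycle_apply_right.2 (SameCycle.refl σ x))
    · intro x y hxy
      by_cases hx : ∃ n : ℕ, D ((σ ^ n) x) <;> by_cases hy : ∃ n : ℕ, D ((σ ^ n) y)
      · simp only [f, dif_pos hx, dif_pos hy, Sum.inr.injEq, Subtype.mk.injEq] at hxy
        rw [quot_mk_eq_pow x (Nat.find hx) fun i hi => Nat.find_min hx hi,
          quot_mk_eq_pow y (Nat.find hy) fun i hi => Nat.find_min hy hi, hxy]
      · simp [f, dif_pos hx, dif_neg hy] at hxy
      · simp [f, dif_neg hx, dif_pos hy] at hxy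
      · simp only [f, dif_neg hx, dif_neg hy, Sum.inl.injEq, Subtype.mk.injEq] at hxy
        obtain ⟨n, rfl⟩ := (Quotient.exact hxy : σ.SameCycle x y).exists_nat_pow_eq
        exact quot_mk_eq_pow x n fun i _ hi => hx ⟨i, hi⟩
    · rintro (⟨q, hq⟩ | ⟨x, hx⟩)
      · obtain ⟨x, rfl⟩ := Quotient.exists_rep q
        have h : ¬ ∃ n : ℕ, D ((σ ^ n) x) := by
          rintro ⟨n, hn⟩
          exact hq ⟨_, hn, Quotient.sound (sameCycle_pow_left.2 (SameCycle.refl σ x))⟩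
        exact ⟨x, by simp only [f, dif_neg h]⟩
      · have h : ∃ n : ℕ, D ((σ ^ n) x) := ⟨0, hx⟩
        have h0 : Nat.find h = 0 := (Nat.find_eq_zero h).2 hx
        exact ⟨x, by simp only [f, dif_pos h, h0, pow_zero, one_apply]⟩
  have hc := Nat.card_congr (Equiv.sumCompl fun q : σ.Cycles => ∃ x, D x ∧ (⟦x⟧ : σ.Cycles) = q)
  rw [Nat.card_sum] at hc
  rw [hcard, Nat.card_sum, ← hc]
  omega

theorem card_quot_eq_card_cycles [Finite X] (σ : Perm X) :
    Nat.card (Quot fun x y => y = σ x) = Nat.card σ.Cycles := by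
  simpa using card_quot_add_card_cycles σ fun _ => False

theorem card_cycles_eq [Fintype X] [DecidableEq X] (σ : Perm X) :
    Nat.card σ.Cycles = σ.cycleType.card + Nat.card {x // σ x = x} := by
  let f : X → {c // c ∈ σ.cycleFactorsFinset} ⊕ {x // σ x = x} := fun x =>
    if h : σ x = x then Sum.inr ⟨x, h⟩
    else Sum.inl ⟨σ.cycleOf x, cycleOf_mem_cycleFactorsFinset_iff.2 (mem_support.2 h)⟩
  have hcard : Nat.card σ.Cycles =
      Nat.card ({c // c ∈ σ.cycleFactorsFinset} ⊕ {x // σ x = x}) := by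
    refine card_quot_eq_of_kernel f ?_ ?_ ?_
    · intro x y (hxy : σ.SameCycle x y)
      by_cases h : σ x = x
      · rw [hxy.eq_of_left h]
      · have h' : ¬ σ y = y := fun h' => h (hxy.apply_eq_self_iff.2 h')
        simp only [f, dif_neg h, dif_neg h', hxy.cycleOf_eq]
    · intro x y hxy
      by_cases hx : σ x = x <;> by_cases hy : σ y = y
      · simp only [f, dif_pos hx, dif_pos hy, Sum.inr.injEq, Subtype.mk.injEq] at hxy
        rw [hxy]
      · simp [f, dif_pos hx, dif_neg hy] at hxy
      · simp [f, dif_neg hx, dif_pos hy] at hxy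
      · simp only [f, dif_neg hx, dif_neg hy, Sum.inl.injEq, Subtype.mk.injEq] at hxy
        refine Quot.sound (show σ.SameCycle x y from ?_)
        by_contra hn
        have h1 : σ.cycleOf y x = x := by
          rw [cycleOf_apply_of_not_sameCycle fun h => hn h.symm]
        rw [← hxy, cycleOf_apply_self] at h1
        exact hx h1
    · rintro (⟨c, hc⟩ | ⟨x, hx⟩)
      · obtain ⟨x, hx⟩ := (mem_cycleFactorsFinset_iff.1 hc).1.nonempty_support
        have hs : x ∈ σ.support := mem_cycleFactorsFinset_support_le hc hx
        have h : ¬ σ x = x := mem_support.1 hs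
        exact ⟨x, by simp only [f, dif_neg h, ← cycle_is_cycleOf hx hc]⟩
      · exact ⟨x, by simp only [f, dif_pos hx]⟩
  rw [hcard, Nat.card_sum, cycleType_def, Multiset.card_map]
  simp

theorem card_support_add_card_fixed [Fintype X] [DecidableEq X] (σ : Perm X) :
    σ.support.card + Nat.card {x // σ x = x} = Fintype.card X := by
  have := σ.support.card_add_card_compl
  rw [Nat.card_eq_fintype_card, Fintype.card_subtype]
  convert this using 3
  ext x
  simp

theorem sign_eq_neg_one_pow_card_cycles [Fintype X] [DecidableEq X] (σ : Perm X) :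
    sign σ = (-1) ^ (Fintype.card X + Nat.card σ.Cycles) := by
  have h1 := card_cycles_eq σ
  have h2 := card_support_add_card_fixed σ
  rw [sign_of_cycleType, sum_cycleType, h1, ← h2]
  have : σ.support.card + Nat.card {x // σ x = x} +
      (σ.cycleType.card + Nat.card {x // σ x = x}) =
      σ.support.card + σ.cycleType.card + 2 * Nat.card {x // σ x = x} := by ring
  rw [this, pow_add _ (_ + _), pow_mul]
  simp

theorem two_mul_card_cycles_of_involutive [Fintype X] [DecidableEq X] (σ : Perm X)
    (h : ∀ x, σ (σ x) = x) :
    2 * Nat.card σ.Cycles = Fintype.card X + Nat.card {x // σ x = x} := by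
  have h1 := card_cycles_eq σ
  have h2 := card_support_add_card_fixed σ
  have h3 := cycleType_of_pow_prime_eq_one (p := 2) (σ := σ) (by ext x; simp [pow_two, h])
  have h4 := σ.sum_cycleType
  rw [h3, Multiset.sum_replicate, smul_eq_mul] at h4
  have h5 : σ.cycleType.card * 2 = σ.support.card := h4
  omega

end Equiv.Perm

/-! ### The cohomology of a quadriculated annulus -/

namespace QuadSurface

open Equiv Equiv.Perm

variable {S : Type*} (A : QuadSurface S)

/-- The gluing of sides as a permutation; boundary sides are its fixed points. -/
def gluePerm : Perm (S × ZMod 4) := Function.Involutive.toPerm A.glue A.glue_glue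

/-- The permutation of the sides that turns each square counterclockwise by one side. -/
def nextPerm (S : Type*) : Perm (S × ZMod 4) := prodCongrRight fun _ => Equiv.addRight 1

/-- `rot` as a permutation. A boundary side is not glued to anything, so `rot` takes it to the next
corner along the boundary: the cycles of `rotPerm` are the interior vertices and the boundary
circles. They are the vertices of the closed surface in which each boundary circle is collapsed to
a point. -/
def rotPerm : Perm (S × ZMod 4) := nextPerm S * A.gluePerm

theorem gluePerm_apply (x : S × ZMod 4) : A.gluePerm x = A.glue x := rfl

theorem rotPerm_apply (x : S × ZMod 4) : A.rotPerm x = A.rot x := rfl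

/-- The boundary circles, as cycles of `rotPerm`. -/
abbrev BoundaryCircle : Type _ :=
  {q : A.rotPerm.Cycles // ∃ x, A.IsBoundarySide x ∧ (⟦x⟧ : A.rotPerm.Cycles) = q}

theorem rot_glue (x : S × ZMod 4) : A.rot (A.glue x) = next x := by
  rw [rot, A.glue_glue]

theorem isBoundarySide_glue {x : S × ZMod 4} :
    A.IsBoundarySide (A.glue x) ↔ A.IsBoundarySide x := by
  unfold IsBoundarySide
  rw [A.glue_glue, eq_comm]

theorem sign_nextPerm [Fintype S] [DecidableEq S] :
    Perm.sign (nextPerm S) = (-1) ^ Fintype.card S := by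
  have h : Perm.sign (Equiv.addRight (1 : ZMod 4)) = -1 := by decide
  rw [nextPerm, sign_prodCongrRight]
  simp [h]

theorem card_sides [Fintype S] : Fintype.card (S × ZMod 4) = 4 * Fintype.card S := by
  rw [Fintype.card_prod, ZMod.card, mul_comm]

theorem card_vertex_add [Fintype S] :
    Nat.card A.Vertex + Nat.card A.BoundaryCircle =
      Nat.card A.rotPerm.Cycles + Nat.card {x // A.IsBoundarySide x} :=
  card_quot_add_card_cycles A.rotPerm A.IsBoundarySide

theorem card_edge [Fintype S] : Nat.card A.Edge = Nat.card A.gluePerm.Cycles :=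
  card_quot_eq_card_cycles A.gluePerm

theorem two_mul_card_edge [Fintype S] [DecidableEq S] :
    2 * Nat.card A.Edge = 4 * Fintype.card S + Nat.card {x // A.IsBoundarySide x} := by
  rw [card_edge, two_mul_card_cycles_of_involutive A.gluePerm A.glue_glue, card_sides]
  rfl

theorem even_card_rotPerm_cycles_add [Fintype S] [DecidableEq S] :
    Even (Nat.card A.rotPerm.Cycles + Fintype.card S + Nat.card A.Edge) := by
  have h : Perm.sign A.rotPerm = Perm.sign (nextPerm S) * Perm.sign A.gluePerm :=
    Perm.sign_mul _ _
  rw [sign_nextPerm, sign_eq_neg_one_pow_card_cycles, sign_eq_neg_one_pow_card_cycles, ← card_edge,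
    ← pow_add] at h
  have h2 : (-1 : ℤˣ) ^ (Nat.card A.rotPerm.Cycles + Fintype.card S + Nat.card A.Edge +
      2 * Fintype.card (S × ZMod 4)) = 1 := by
    have : Nat.card A.rotPerm.Cycles + Fintype.card S + Nat.card A.Edge +
      2 * Fintype.card (S × ZMod 4) = (Fintype.card (S × ZMod 4) + Nat.card A.rotPerm.Cycles) +
      (Fintype.card S + (Fintype.card (S × ZMod 4) + Nat.card A.Edge)) := by ring
    rw [this, pow_add, h, ← pow_add, ← two_mul, pow_mul]
    simp
  rw [neg_one_pow_eq_one_iff_even (by decide)] at h2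
  simpa [Nat.even_add] using h2

variable {A}

theorem IsAnnulus.card_boundaryCircle_eq [Fintype S] [DecidableEq S] (hA : A.IsAnnulus) :
    (Nat.card A.BoundaryCircle : ℤ) =
      Nat.card A.rotPerm.Cycles + Nat.card A.Edge - 3 * Fintype.card S := by
  have h1 := A.card_vertex_add
  have h2 := A.two_mul_card_edge
  have h3 := hA.eulerChar_eq_zero
  rw [eulerChar, Nat.card_eq_fintype_card (α := S)] at h3
  omega

/-- The genus is an integer: a compact oriented surface of Euler characteristic `0` has an even
number of boundary circles. -/
theorem IsAnnulus.even_card_boundaryCircle [Fintype S] [DecidableEq S] (hA : A.IsAnnulus) :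
    Even (Nat.card A.BoundaryCircle) := by
  have h1 := hA.card_boundaryCircle_eq
  obtain ⟨k, hk⟩ := A.even_card_rotPerm_cycles_add
  rw [Nat.even_iff]
  omega

theorem IsAnnulus.card_boundaryCircle_pos [Fintype S] (hA : A.IsAnnulus) :
    0 < Nat.card A.BoundaryCircle := by
  obtain ⟨x, hx⟩ := hA.boundary_nonempty
  have : Nonempty A.BoundaryCircle := ⟨⟨⟦x⟧, x, hx, rfl⟩⟩
  exact Nat.card_pos

/-- Induction over the sides of a connected surface. -/
theorem IsAnnulus.forall_side (hA : A.IsAnnulus) {P : S × ZMod 4 → Prop}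
    (hn : ∀ x, P x → P (next x)) (hg : ∀ x, P x → P (A.glue x)) {x₀ : S × ZMod 4} (h₀ : P x₀)
    (x : S × ZMod 4) : P x := by
  have hsq : ∀ s i, P (s, i) → ∀ j, P (s, j) := by
    intro s i hi
    have h1 := hn _ hi
    have h2 := hn _ h1
    have h3 := hn _ h2
    simp only [next] at h1 h2 h3
    intro j
    have : j = i ∨ j = i + 1 ∨ j = i + 1 + 1 ∨ j = i + 1 + 1 + 1 := by
      clear h1 h2 h3 hi
      revert i j; decide
    rcases this with rfl | rfl | rfl | rfl <;> assumption
  have key : ∀ s j, P (s, j) := by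
    intro s
    induction hA.connected x₀.1 s with
    | refl => exact hsq _ _ h₀
    | tail _ hbc ih =>
      obtain ⟨i, -, rfl⟩ := hbc
      exact hsq _ _ (hg _ (ih i))
  exact key x.1 x.2

variable (A) in
/-- Antisymmetric functions on the sides (`x` and `glue x` are the two directions of an edge; over `ℤ`
and `ℚ`, boundary sides get the value `0`) whose sum over the boundary of each square vanishes: the
cocycles of the surface relative to its boundary. In the dual graph they are the circulations. -/
structure IsCocycle {R : Type*} [Ring R] (c : S × ZMod 4 → R) : Prop where
  glue : ∀ x, c (A.glue x) = -c x
  sum_eq_zero : ∀ s, ∑ i, c (s, i) = 0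

theorem sum_single [DecidableEq S] {R : Type*} [Ring R] (y : S × ZMod 4) (s : S) :
    ∑ i, (if (s, i) = y then (1 : R) else 0) = if s = y.1 then 1 else 0 := by
  obtain ⟨a, j⟩ := y
  by_cases h : s = a
  · subst h
    simp
  · simp [h]

/-- A path of squares, as a flow on the dual graph with source `a` and sink `b`. -/
theorem exists_flow_of_path [Fintype S] [DecidableEq S] (E : Set (S × ZMod 4)) {a b : S}
    (h : Relation.ReflTransGen (fun a b => ∃ i, (a, i) ∈ E ∧ (A.glue (a, i)).1 = b) a b) :
    ∃ c : S × ZMod 4 → ℤ, (∀ x, c (A.glue x) = -c x) ∧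
      (∀ s, ∑ i, c (s, i) = (if s = b then 1 else 0) - if s = a then 1 else 0) ∧
      ∀ f : S × ZMod 4 → ℤ, (∀ x, f (A.glue x) = -f x) → (∀ x ∈ E, f x = 0) →
        ∑ x, c x * f x = 0 := by
  induction h with
  | refl => exact ⟨0, by simp⟩
  | @tail b d _ hbd ih =>
    obtain ⟨i, hi, rfl⟩ := hbd
    obtain ⟨c, h1, h2, h3⟩ := ih
    refine ⟨fun x => c x + (if x = A.glue (b, i) then 1 else 0) - if x = (b, i) then 1 else 0,
      ?_, ?_, ?_⟩
    · intro x
      have e1 : A.glue x = A.glue (b, i) ↔ x = (b, i) := A.gluePerm.injective.eq_iff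
      have e2 : A.glue x = (b, i) ↔ x = A.glue (b, i) :=
        ⟨fun h => by rw [← h, A.glue_glue], fun h => by rw [h, A.glue_glue]⟩
      simp only [h1, e1, e2]
      ring
    · intro s
      rw [Finset.sum_sub_distrib, Finset.sum_add_distrib, h2, sum_single, sum_single]
      ring
    · intro f hf hE
      have := h3 f hf hE
      simp only [add_mul, sub_mul, Finset.sum_add_distrib, Finset.sum_sub_distrib, this, ite_mul,
        one_mul, zero_mul, Finset.sum_ite_eq', Finset.mem_univ, if_true, hf, hE _ hi]
      simp

variable (A) in
/-- The sum of a function and its composition with the gluing. Its kernel consists of the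
antisymmetric functions. -/
def symmetrize : (S × ZMod 4 → ℚ) →ₗ[ℚ] (S × ZMod 4 → ℚ) :=
  LinearMap.id + LinearMap.funLeft ℚ ℚ A.glue

variable (S) in
/-- The sums of a function on the sides over the boundaries of the squares. -/
def squareSum : (S × ZMod 4 → ℚ) →ₗ[ℚ] (S → ℚ) where
  toFun c s := ∑ i, c (s, i)
  map_add' c d := by ext s; simp [Finset.sum_add_distrib]
  map_smul' r c := by ext s; simp [Finset.mul_sum]

variable (A) in
/-- The rational cocycles. -/
def cocycles : Submodule ℚ (S × ZMod 4 → ℚ) where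
  carrier := {c | A.IsCocycle c}
  add_mem' := fun {c d} hc hd =>
    ⟨fun x => by simp [hc.glue, hd.glue, add_comm],
      fun s => by simp [Finset.sum_add_distrib, hc.sum_eq_zero, hd.sum_eq_zero]⟩
  zero_mem' := ⟨fun x => by simp, fun s => by simp⟩
  smul_mem' := fun r c hc =>
    ⟨fun x => by simp [hc.glue], fun s => by simp [← Finset.mul_sum, hc.sum_eq_zero]⟩

variable (A) in
/-- The coboundary of a function on the cycles of `rotPerm`. The vertices at the two ends of the
side `x` belong to the cycles of `x` and of `glue x`. -/
def coboundary : (A.rotPerm.Cycles → ℚ) →ₗ[ℚ] (S × ZMod 4 → ℚ) :=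
  LinearMap.funLeft ℚ ℚ (fun x => (⟦A.glue x⟧ : A.rotPerm.Cycles)) -
    LinearMap.funLeft ℚ ℚ (fun x => (⟦x⟧ : A.rotPerm.Cycles))

theorem coboundary_apply (g : A.rotPerm.Cycles → ℚ) (x : S × ZMod 4) :
    A.coboundary g x = g ⟦A.glue x⟧ - g ⟦x⟧ := rfl

theorem mk_rot (x : S × ZMod 4) : (⟦A.rot x⟧ : A.rotPerm.Cycles) = ⟦x⟧ :=
  Quotient.sound (sameCycle_apply_left.2 (SameCycle.refl A.rotPerm x))

theorem mk_next (x : S × ZMod 4) : (⟦next x⟧ : A.rotPerm.Cycles) = ⟦A.glue x⟧ := by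
  rw [← A.rot_glue, mk_rot]

theorem range_coboundary_le : LinearMap.range A.coboundary ≤ A.cocycles := by
  rintro _ ⟨g, rfl⟩
  refine ⟨fun x => by simp [coboundary_apply, A.glue_glue], fun s => ?_⟩
  have h : ∀ i, A.coboundary g (s, i) = g ⟦(s, i + 1)⟧ - g ⟦(s, i)⟧ := fun i => by
    rw [coboundary_apply, ← mk_next]
    rfl
  simp only [h]
  rw [Finset.sum_sub_distrib, sub_eq_zero]
  exact Equiv.sum_comp (Equiv.addRight (1 : ZMod 4)) fun i => g ⟦(s, i)⟧

/-- Antisymmetric functions vanish on boundary sides and are given by one number on each other edge;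
the bound comes from the symmetric functions, which are the functions on the set of all edges. -/
theorem finrank_ker_symmetrize [Fintype S] [DecidableEq S] :
    Module.finrank ℚ (LinearMap.ker A.symmetrize) + Nat.card A.Edge ≤ 4 * Fintype.card S := by
  have h1 := LinearMap.finrank_range_add_finrank_ker A.symmetrize
  rw [Module.finrank_fintype_fun_eq_card, card_sides] at h1
  have h2 : Nat.card A.Edge ≤ Module.finrank ℚ (LinearMap.range A.symmetrize) := by
    classical
    have := Fintype.ofFinite A.gluePerm.Cycles
    have hi : Function.Injective
        (LinearMap.funLeft ℚ ℚ (fun x => (⟦x⟧ : A.gluePerm.Cycles))) :=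
      LinearMap.funLeft_injective_of_surjective _ _ _ Quotient.mk_surjective
    have hle : LinearMap.range (LinearMap.funLeft ℚ ℚ (fun x => (⟦x⟧ : A.gluePerm.Cycles))) ≤
        LinearMap.range A.symmetrize := by
      rintro _ ⟨g, rfl⟩
      refine ⟨fun x => g ⟦x⟧ / 2, ?_⟩
      ext x
      have : (⟦A.glue x⟧ : A.gluePerm.Cycles) = ⟦x⟧ :=
        Quotient.sound (sameCycle_apply_left.2 (SameCycle.refl A.gluePerm x))
      simp [symmetrize, LinearMap.funLeft_apply, this]
    have h3 := Submodule.finrank_mono hle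
    rwa [LinearMap.finrank_range_of_inj hi, Module.finrank_fintype_fun_eq_card,
      ← Nat.card_eq_fintype_card, ← card_edge] at h3
  omega

/-- Connectedness makes the map from antisymmetric functions to square sums as surjective as
possible: its image has codimension at most one. -/
theorem IsAnnulus.finrank_cocycles_add [Fintype S] [DecidableEq S] (hA : A.IsAnnulus) :
    Module.finrank ℚ A.cocycles + Nat.card A.Edge ≤ 3 * Fintype.card S + 1 := by
  obtain ⟨x₀, -⟩ := hA.boundary_nonempty
  let L := (squareSum S).domRestrict (LinearMap.ker A.symmetrize)
  have h1 := LinearMap.finrank_range_add_finrank_ker L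
  have h2 := finrank_ker_symmetrize (A := A)
  have mem_anti : ∀ c : S × ZMod 4 → ℚ,
      c ∈ LinearMap.ker A.symmetrize ↔ ∀ x, c (A.glue x) = -c x := fun c => by
    rw [LinearMap.mem_ker, funext_iff]
    simp only [symmetrize, LinearMap.add_apply, LinearMap.id_apply, Pi.add_apply,
      LinearMap.funLeft_apply, Pi.zero_apply]
    exact forall_congr' fun x => ⟨fun h => by linarith, fun h => by linarith⟩
  have h3 : Module.finrank ℚ (LinearMap.ker L) = Module.finrank ℚ A.cocycles := by
    suffices hmap : (LinearMap.ker L).map (LinearMap.ker A.symmetrize).subtype = A.cocycles by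
      rw [← hmap, Submodule.finrank_map_subtype_eq]
    ext c
    simp only [Submodule.mem_map, LinearMap.mem_ker, Subtype.exists, Submodule.subtype_apply,
      exists_and_right, exists_eq_right]
    constructor
    · rintro ⟨hc, hL⟩
      exact ⟨(mem_anti c).1 hc, fun s => congrFun hL s⟩
    · rintro ⟨hc, hs⟩
      exact ⟨(mem_anti c).2 hc, funext hs⟩
  have h4 : Fintype.card S ≤ Module.finrank ℚ (LinearMap.range L) + 1 := by
    have htop : LinearMap.range L ⊔ Submodule.span ℚ {Pi.single x₀.1 1} = ⊤ := by
      rw [eq_top_iff, ← (Pi.basisFun ℚ S).span_eq, Submodule.span_le]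
      rintro _ ⟨s, rfl⟩
      obtain ⟨c, hc, hsum, -⟩ := exists_flow_of_path Set.univ (hA.connected x₀.1 s)
      have hmem : (Pi.single s 1 - Pi.single x₀.1 1 : S → ℚ) ∈ LinearMap.range L := by
        refine ⟨⟨fun x => c x, (mem_anti _).2 fun x => by rw [hc]; push_cast; rfl⟩, ?_⟩
        ext u
        have := hsum u
        have h' : ((∑ i, c (u, i) : ℤ) : ℚ) = _ := congrArg _ this
        push_cast at h'
        simpa [L, squareSum, Pi.single_apply] using h'
      have := Submodule.add_mem_sup hmem
        (Submodule.mem_span_singleton_self (R := ℚ) (Pi.single x₀.1 1 : S → ℚ))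
      simpa using this
    have h5 := Submodule.finrank_add_le_finrank_add_finrank (LinearMap.range L)
      (Submodule.span ℚ {(Pi.single x₀.1 1 : S → ℚ)})
    rw [htop, finrank_top, Module.finrank_fintype_fun_eq_card] at h5
    have h6 := finrank_span_le_card (R := ℚ) ({Pi.single x₀.1 1} : Set (S → ℚ))
    simp at h6
    omega
  omega

/-- The kernel of the coboundary map consists of constants. -/
theorem IsAnnulus.card_cycles_le_finrank_range_coboundary [Fintype S] [DecidableEq S]
    (hA : A.IsAnnulus) :
    Nat.card A.rotPerm.Cycles ≤ Module.finrank ℚ (LinearMap.range A.coboundary) + 1 := by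
  obtain ⟨x₀, -⟩ := hA.boundary_nonempty
  classical
  have := Fintype.ofFinite A.rotPerm.Cycles
  have h1 := LinearMap.finrank_range_add_finrank_ker A.coboundary
  rw [Module.finrank_fintype_fun_eq_card, ← Nat.card_eq_fintype_card] at h1
  have h2 : LinearMap.ker A.coboundary ≤ Submodule.span ℚ {fun _ => 1} := by
    intro g hg
    have hglue : ∀ x, g ⟦A.glue x⟧ = g ⟦x⟧ := fun x =>
      sub_eq_zero.1 (congrFun (LinearMap.mem_ker.1 hg) x)
    refine Submodule.mem_span_singleton.2 ⟨g ⟦x₀⟧, ?_⟩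
    ext q
    induction q using Quotient.inductionOn with
    | h x =>
      have := hA.forall_side (P := fun x => g ⟦x⟧ = g ⟦x₀⟧)
        (fun x hx => by rw [mk_next, hglue, hx]) (fun x hx => by rw [hglue, hx]) rfl x
      simp [this]
  have h3 := Submodule.finrank_mono h2
  have h4 := finrank_span_le_card (R := ℚ) ({fun _ => 1} : Set (A.rotPerm.Cycles → ℚ))
  simp at h4
  omega

/-- The coboundaries are cocycles, so the dimensions leave room for at most two boundary circles;
their number is even and not zero. -/
theorem IsAnnulus.card_boundaryCircle [Fintype S] [DecidableEq S] (hA : A.IsAnnulus) :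
    Nat.card A.BoundaryCircle = 2 := by
  have h1 := hA.card_boundaryCircle_eq
  have h2 := hA.finrank_cocycles_add
  have h3 := hA.card_cycles_le_finrank_range_coboundary
  have h4 := Submodule.finrank_mono (range_coboundary_le (A := A))
  have h5 := hA.card_boundaryCircle_pos
  obtain ⟨k, hk⟩ := hA.even_card_boundaryCircle
  omega

/-- Collapsing the two boundary circles gives a sphere, so every relative cocycle is a coboundary. -/
theorem IsAnnulus.range_coboundary [Fintype S] [DecidableEq S] (hA : A.IsAnnulus) :
    LinearMap.range A.coboundary = A.cocycles := by
  refine Submodule.eq_of_le_of_finrank_le range_coboundary_le ?_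
  have h1 := hA.card_boundaryCircle_eq
  have h2 := hA.finrank_cocycles_add
  have h3 := hA.card_cycles_le_finrank_range_coboundary
  have h4 := hA.card_boundaryCircle
  omega

end QuadSurface

/-! ### Potentials and relative cycles -/

namespace QuadSurface

open Equiv Equiv.Perm

variable {S : Type*} {A : QuadSurface S}

/-- A potential of an integer cocycle: a function on the cycles of `rotPerm` (interior vertices and
boundary circles), lifted to the sides, whose coboundary is the cocycle. -/
structure IsPotential (A : QuadSurface S) (c : S × ZMod 4 → ℤ) (h : S × ZMod 4 → ℚ) : Prop where
  rot : ∀ x, h (A.rot x) = h x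
  eq_sub : ∀ x, (c x : ℚ) = h (A.glue x) - h x

theorem IsPotential.next {c : S × ZMod 4 → ℤ} {h : S × ZMod 4 → ℚ} (hp : A.IsPotential c h)
    (x : S × ZMod 4) : h (next x) = h (A.glue x) := by
  rw [← A.rot_glue, hp.rot]

theorem IsPotential.sameCycle {c : S × ZMod 4 → ℤ} {h : S × ZMod 4 → ℚ} (hp : A.IsPotential c h)
    {x y : S × ZMod 4} (hxy : A.rotPerm.SameCycle x y) : h x = h y := by
  obtain ⟨n, rfl⟩ := hxy
  induction n using Int.induction_on with
  | zero => rfl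
  | succ n ih =>
    rw [ih, add_comm, zpow_add, zpow_one, mul_apply, rotPerm_apply, hp.rot]
  | pred n ih =>
    rw [ih, ← hp.rot ((A.rotPerm ^ (-(n : ℤ) - 1)) x), ← rotPerm_apply, ← mul_apply,
      ← zpow_one_add]
    congr 3
    ring

/-- The relative cocycles of an annulus are exact. -/
theorem IsAnnulus.exists_isPotential [Fintype S] [DecidableEq S] (hA : A.IsAnnulus)
    {c : S × ZMod 4 → ℤ} (hc : A.IsCocycle c) : ∃ h, A.IsPotential c h := by
  have hmem : (fun x => (c x : ℚ)) ∈ A.cocycles :=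
    ⟨fun x => by rw [hc.glue]; push_cast; rfl, fun s => by exact_mod_cast hc.sum_eq_zero s⟩
  rw [← hA.range_coboundary] at hmem
  obtain ⟨g, hg⟩ := hmem
  exact ⟨fun x => g ⟦x⟧, fun x => by rw [mk_rot], fun x => (congrFun hg x).symm⟩

theorem IsAnnulus.exists_boundaryCircles [Fintype S] [DecidableEq S] (hA : A.IsAnnulus) :
    ∃ x₁ x₂, ∀ x, A.IsBoundarySide x →
      A.rotPerm.SameCycle x₁ x ∨ A.rotPerm.SameCycle x₂ x := by
  obtain ⟨⟨q₁, x₁, h₁, rfl⟩, ⟨q₂, x₂, h₂, rfl⟩, -, huniv⟩ :=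
    Nat.card_eq_two_iff.1 hA.card_boundaryCircle
  refine ⟨x₁, x₂, fun x hx => ?_⟩
  have hmem := huniv ▸ Set.mem_univ (⟨⟦x⟧, x, hx, rfl⟩ : A.BoundaryCircle)
  simp only [Set.mem_insert_iff, Set.mem_singleton_iff, Subtype.mk.injEq] at hmem
  exact hmem.imp (fun h => Quotient.exact h.symm) fun h => Quotient.exact h.symm

theorem sum_eq_zero_of_glue [Fintype S] {f : S × ZMod 4 → ℚ} (hf : ∀ x, f (A.glue x) = -f x) :
    ∑ x, f x = 0 := by
  have h := Equiv.sum_comp A.gluePerm f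
  simp only [gluePerm_apply, hf, Finset.sum_neg_distrib] at h
  linarith

theorem sameCycle_of_src_eq {x y : S × ZMod 4} (h : A.src x = A.src y) :
    A.rotPerm.SameCycle x y := by
  let F : A.Vertex → A.rotPerm.Cycles := Quot.lift (fun x => ⟦x⟧) (by
    rintro x _ ⟨-, rfl⟩
    exact (mk_rot x).symm)
  exact Quotient.exact (congrArg F h)

variable (A) in
/-- An antisymmetric function on the sides (a 1-chain) whose values at the four sides that start at an
interior vertex have sum zero: its boundary is supported on the boundary of the surface. The four
sides are listed from a white corner of the vertex. -/
structure IsRelativeCycle (white : Finset S) (f : S × ZMod 4 → ℚ) : Prop where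
  glue : ∀ x, f (A.glue x) = -f x
  sum_eq_zero : ∀ x, A.IsInteriorVertex (A.src x) → x.1 ∈ white →
    f x + f (A.rot x) + f (A.rot (A.rot x)) + f (A.rot (A.rot (A.rot x))) = 0

/-- The pairing of a relative cycle with the coboundary of a function that vanishes on the boundary
circles is zero. Each interior vertex is summed over its white corners, so the number of squares
around it does not matter. -/
theorem IsRelativeCycle.sum_mul_eq_zero_of_interior [Fintype S] [DecidableEq S] {white : Finset S}
    (hwhite : A.IsBalancedBicoloring white) {f : S × ZMod 4 → ℚ}
    (hf : A.IsRelativeCycle white f) {g : S × ZMod 4 → ℚ} (hg : ∀ x, g (A.rot x) = g x)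
    (hg0 : ∀ x, g x ≠ 0 → ∀ y, A.rotPerm.SameCycle x y → ¬ A.IsBoundarySide y) :
    ∑ x, g x * f x = 0 := by
  -- `a` and `b` are the restrictions of `g` to white and black corners; `rot` exchanges them.
  let a : S × ZMod 4 → ℚ := fun x => if x.1 ∈ white then g x else 0
  let b : S × ZMod 4 → ℚ := fun x => if x.1 ∈ white then 0 else g x
  have hab : ∀ x, g x = a x + b x := fun x => by
    by_cases h : x.1 ∈ white <;> simp [a, b, h]
  have halt : ∀ x, g x ≠ 0 → (x.1 ∈ white ↔ (A.rot x).1 ∉ white) := fun x hx =>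
    hwhite.alternating x (hg0 x hx x (SameCycle.refl _ x))
  have hb : ∀ x, b (A.rot x) = a x := fun x => by
    by_cases h0 : g x = 0
    · simp [a, b, hg, h0]
    · by_cases h : x.1 ∈ white <;> simp [a, b, hg, h, ← halt x h0]
  have ha : ∀ x, a (A.rot x) = b x := fun x => by
    have h1 := hab x
    have h2 := hab (A.rot x)
    rw [hg, hb] at h2
    linarith
  have hcomp : ∀ u : S × ZMod 4 → ℚ, ∑ x, u (A.rot x) = ∑ x, u x := fun u =>
    Equiv.sum_comp A.rotPerm u
  have hzero : ∑ x, a x * (f x + f (A.rot x) + f (A.rot (A.rot x)) +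
      f (A.rot (A.rot (A.rot x)))) = 0 := by
    refine Finset.sum_eq_zero fun x _ => ?_
    by_cases h0 : a x = 0
    · rw [h0, zero_mul]
    · have hw : x.1 ∈ white := by
        by_contra hw
        exact h0 (if_neg hw)
      have hgx : g x ≠ 0 := by simpa [a, hw] using h0
      rw [hf.sum_eq_zero x (fun y hy => hg0 x hgx y (sameCycle_of_src_eq hy).symm) hw, mul_zero]
  have e1 : ∑ x, a x * f (A.rot x) = ∑ x, b x * f x := by
    simpa only [hb] using hcomp fun x => b x * f x
  have e2 : ∑ x, a x * f (A.rot (A.rot x)) = ∑ x, a x * f x := by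
    simpa only [ha, hb] using
      (hcomp fun x => a (A.rot x) * f (A.rot x)).trans (hcomp fun x => a x * f x)
  have e3 : ∑ x, a x * f (A.rot (A.rot (A.rot x))) = ∑ x, b x * f x := by
    simpa only [ha, hb] using
      ((hcomp fun x => b (A.rot (A.rot x)) * f (A.rot (A.rot x))).trans
        (hcomp fun x => b (A.rot x) * f (A.rot x))).trans (hcomp fun x => b x * f x)
  simp only [mul_add, Finset.sum_add_distrib, e1, e2, e3] at hzero
  simp only [hab, add_mul, Finset.sum_add_distrib]
  linarith

theorem IsRelativeCycle.sum_mul_eq_zero [Fintype S] [DecidableEq S] {white : Finset S}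
    (hwhite : A.IsBalancedBicoloring white) {f : S × ZMod 4 → ℚ}
    (hf : A.IsRelativeCycle white f) {x₁ x₂ : S × ZMod 4}
    (hx : ∀ x, A.IsBoundarySide x → A.rotPerm.SameCycle x₁ x ∨ A.rotPerm.SameCycle x₂ x)
    {g : S × ZMod 4 → ℚ} (hg : ∀ x y, A.rotPerm.SameCycle x y → g x = g y) (h12 : g x₁ = g x₂) :
    ∑ x, g x * f x = 0 := by
  have h1 := hf.sum_mul_eq_zero_of_interior hwhite (g := fun x => g x - g x₁)
    (fun x => by
      rw [hg (A.rot x) x (sameCycle_apply_left.2 (SameCycle.refl A.rotPerm x))])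
    (fun x hgx y hxy hy => by
      refine hgx (sub_eq_zero.2 ?_)
      rcases hx y hy with h | h
      · exact hg _ _ (hxy.trans h.symm)
      · rw [h12]
        exact hg _ _ (hxy.trans h.symm))
  simp only [sub_mul, Finset.sum_sub_distrib, ← Finset.mul_sum, sum_eq_zero_of_glue hf.glue] at h1
  linarith

theorem IsPotential.sum_mul_eq [Fintype S] {c : S × ZMod 4 → ℤ} {h : S × ZMod 4 → ℚ}
    (hp : A.IsPotential c h) {f : S × ZMod 4 → ℚ} (hf : ∀ x, f (A.glue x) = -f x) :
    ∑ x, (c x : ℚ) * f x = -2 * ∑ x, h x * f x := by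
  have h1 : ∑ x, h (A.glue x) * f x = -∑ x, h x * f x := by
    rw [← Equiv.sum_comp A.gluePerm, ← Finset.sum_neg_distrib]
    exact Finset.sum_congr rfl fun x _ => by rw [gluePerm_apply, A.glue_glue, hf]; ring
  simp only [hp.eq_sub, sub_mul, Finset.sum_sub_distrib, h1]
  ring

/-- The pairing of a relative cycle `f` with cocycles is proportional to the difference of the
values of their potentials on the two boundary circles. If it takes the value `±2` (each edge counts
twice), then it is at most `2` on all cocycles for which this difference is at most `1`. -/
theorem IsAnnulus.abs_sum_mul_le [Fintype S] [DecidableEq S] {white : Finset S}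
    (hwhite : A.IsBalancedBicoloring white) (hA : A.IsAnnulus) {f : S × ZMod 4 → ℚ}
    (hf : A.IsRelativeCycle white f) {c₀ : S × ZMod 4 → ℤ} (hc₀ : A.IsCocycle c₀)
    (h₀ : |∑ x, (c₀ x : ℚ) * f x| = 2) {c : S × ZMod 4 → ℤ} {h : S × ZMod 4 → ℚ}
    (hp : A.IsPotential c h) (hle : ∀ x y, |h x - h y| ≤ 1) :
    |∑ x, (c x : ℚ) * f x| ≤ 2 := by
  obtain ⟨x₁, x₂, hx⟩ := hA.exists_boundaryCircles
  obtain ⟨k, hk⟩ := hA.exists_isPotential hc₀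
  have hprop : (k x₁ - k x₂) * ∑ x, (c x : ℚ) * f x =
      (h x₁ - h x₂) * ∑ x, (c₀ x : ℚ) * f x := by
    have := hf.sum_mul_eq_zero hwhite hx
      (g := fun x => (k x₁ - k x₂) * h x - (h x₁ - h x₂) * k x)
      (fun x y hxy => by rw [hp.sameCycle hxy, hk.sameCycle hxy]) (by ring)
    rw [hp.sum_mul_eq hf.glue, hk.sum_mul_eq hf.glue]
    simp only [sub_mul _ _ (f _), Finset.sum_sub_distrib, mul_assoc, ← Finset.mul_sum] at this
    linear_combination (-2) * this
  have hne : k x₁ - k x₂ ≠ 0 := fun h0 => by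
    have := hf.sum_mul_eq_zero hwhite hx (fun x y hxy => hk.sameCycle hxy) (sub_eq_zero.1 h0)
    rw [hk.sum_mul_eq hf.glue, this] at h₀
    norm_num at h₀
  -- The differences of the potential are integers since the surface is connected.
  have hint : ∃ n : ℤ, k x₁ - k x₂ = n := by
    refine hA.forall_side (P := fun x => ∃ n : ℤ, k x - k x₂ = n) ?_ ?_ (x₀ := x₂) ⟨0, by simp⟩ x₁
    · rintro x ⟨n, hn⟩
      exact ⟨n + c₀ x, by rw [hk.next]; push_cast; rw [hk.eq_sub, ← hn]; ring⟩
    · rintro x ⟨n, hn⟩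
      exact ⟨n + c₀ x, by push_cast; rw [hk.eq_sub, ← hn]; ring⟩
  obtain ⟨n, hn⟩ := hint
  have h1 : 1 ≤ |k x₁ - k x₂| := by
    rw [hn] at hne ⊢
    exact_mod_cast Int.one_le_abs (by exact_mod_cast hne)
  have h2 := congrArg abs hprop
  rw [abs_mul, abs_mul, h₀] at h2
  nlinarith [hle x₁ x₂, abs_nonneg (∑ x, (c x : ℚ) * f x)]

/-- A simple closed curve in the annulus has at most two sides: if the cocycle `c` of a curve (with
values `0`, `±1`) has a potential which is equal to `k` immediately to one side of the curve, then
the potential takes at most two values, which differ by `1`. -/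
theorem IsAnnulus.abs_potential_sub_le (hA : A.IsAnnulus) {c : S × ZMod 4 → ℤ}
    (hc : ∀ x, c (A.glue x) = -c x) {h : S × ZMod 4 → ℚ} (hp : A.IsPotential c h)
    (hval : ∀ x, c x = 0 ∨ c x = 1 ∨ c x = -1) {k : ℚ} (hk : ∀ x, c x = 1 → h x = k)
    (x y : S × ZMod 4) : |h x - h y| ≤ 1 := by
  have hk' : ∀ x, c x = -1 → h x = k + 1 ∧ h (A.glue x) = k := fun x hx => by
    have h1 := hk (A.glue x) (by rw [hc, hx]; rfl)
    have h2 := hp.eq_sub x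
    rw [hx, h1] at h2
    push_cast at h2
    exact ⟨by linarith, h1⟩
  have hk1 : ∀ x, c x = 1 → h (A.glue x) = k + 1 := fun x hx => by
    have h2 := hp.eq_sub x
    rw [hx, hk x hx] at h2
    push_cast at h2
    linarith
  have hk0 : ∀ x, c x = 0 → h (A.glue x) = h x := fun x hx => by
    have h2 := hp.eq_sub x
    rw [hx] at h2
    push_cast at h2
    linarith
  by_cases hex : ∃ x, c x = 1
  · obtain ⟨x₀, hx₀⟩ := hex
    have hglue : ∀ x, (h x = k ∨ h x = k + 1) → (h (A.glue x) = k ∨ h (A.glue x) = k + 1) := by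
      intro x hx
      rcases hval x with h0 | h0 | h0
      · rwa [hk0 x h0]
      · exact Or.inr (hk1 x h0)
      · exact Or.inl (hk' x h0).2
    have hall := hA.forall_side (P := fun x => h x = k ∨ h x = k + 1)
      (fun x hx => by rw [hp.next]; exact hglue x hx) hglue (Or.inl (hk x₀ hx₀))
    rcases hall x with h1 | h1 <;> rcases hall y with h2 | h2 <;> rw [h1, h2] <;> simp
  · have hz : ∀ x, c x = 0 := fun x => by
      rcases hval x with h0 | h0 | h0
      · exact h0
      · exact absurd ⟨x, h0⟩ hex
      · exact absurd ⟨A.glue x, by rw [hc, h0]; rfl⟩ hex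
    have hall := hA.forall_side (P := fun x => h x = h y)
      (fun x hx => by rw [hp.next, hk0 x (hz x), hx]) (fun x hx => by rw [hk0 x (hz x), hx]) rfl
    rw [hall x]
    simp

/-! ### The flux as a relative cycle -/

open Classical in
/-- The exponents of `p` in the weights, as a function on the directed edges: from white to black
squares the exponent itself, in the opposite direction its negative, and `0` on boundary sides (where
the weights are not specified). -/
noncomputable def weightFlow (A : QuadSurface S) (white : Finset S)
    (w : S × ZMod 4 → SignedMonomial) (x : S × ZMod 4) : ℤ :=
  if A.IsBoundarySide x then 0 else if x.1 ∈ white then (w x).expP else -(w x).expP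

theorem expP_mul (m n : SignedMonomial) : (m * n).expP = m.expP + n.expP := rfl

theorem interior_rot {x : S × ZMod 4} (hx : A.IsInteriorVertex (A.src x)) :
    A.src (A.rot x) = A.src x :=
  (Quot.sound ⟨hx x rfl, rfl⟩ : A.src x = A.src (A.rot x)).symm

section Weights

variable [Fintype S] [DecidableEq S] {white : Finset S} {w : S × ZMod 4 → SignedMonomial}
  {ξ : A.Cut} {T : Set (S × ZMod 4)} {e : S × ZMod 4}

theorem IsKasteleynWeight.weightFlow_glue (hw : A.IsKasteleynWeight white ξ T e w)
    (hwhite : A.IsBalancedBicoloring white) (x : S × ZMod 4) :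
    A.weightFlow white w (A.glue x) = -A.weightFlow white w x := by
  unfold weightFlow
  by_cases hb : A.IsBoundarySide x
  · rw [if_pos hb, if_pos (A.isBoundarySide_glue.2 hb), neg_zero]
  · rw [if_neg hb, if_neg (A.isBoundarySide_glue.not.2 hb), hw.glue_eq]
    have := hwhite.alternating x hb
    by_cases h : x.1 ∈ white
    · rw [if_pos h, if_neg (this.1 h)]
    · rw [if_neg h, if_pos (not_not.1 (this.not.1 h)), neg_neg]

theorem IsKasteleynWeight.isRelativeCycle (hw : A.IsKasteleynWeight white ξ T e w)
    (hwhite : A.IsBalancedBicoloring white) :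
    A.IsRelativeCycle white fun x => (A.weightFlow white w x : ℚ) where
  glue x := by rw [hw.weightFlow_glue hwhite]; push_cast; rfl
  sum_eq_zero x hx hxw := by
    have h1 := interior_rot hx
    have h2 := interior_rot (h1 ▸ hx : A.IsInteriorVertex (A.src (A.rot x)))
    have h3 := interior_rot (h2 ▸ h1 ▸ hx : A.IsInteriorVertex (A.src (A.rot (A.rot x))))
    have b0 := hx x rfl
    have b1 := hx _ h1
    have b2 := hx _ (h2.trans h1)
    have b3 := hx _ (h3.trans (h2.trans h1))
    have w1 := (hwhite.alternating _ b0).1 hxw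
    have w2 := not_not.1 ((hwhite.alternating _ b1).not.1 w1)
    have w3 := (hwhite.alternating _ b2).1 w2
    have hflip := congrArg SignedMonomial.expP (hw.flip_eq x hx hxw)
    simp only [expP_mul] at hflip
    have hneg : SignedMonomial.negq.expP = 0 := rfl
    change (A.rot x).1 ∉ white at w1
    change (A.rot (A.rot x)).1 ∈ white at w2
    change (A.rot (A.rot (A.rot x))).1 ∉ white at w3
    simp only [weightFlow, if_neg b0, if_neg b1, if_neg b2, if_neg b3, if_pos hxw, if_neg w1,
      if_pos w2, if_neg w3]
    have : ((w x).expP : ℤ) + -(w (A.rot x)).expP + (w (A.rot (A.rot x))).expP +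
        -(w (A.rot (A.rot (A.rot x)))).expP = 0 := by linarith
    exact_mod_cast this

/-- The closed path of squares that crosses `e` once and otherwise runs through the tree has
flux `±1`. -/
theorem IsKasteleynWeight.exists_isCocycle (hw : A.IsKasteleynWeight white ξ T e w)
    (hwhite : A.IsBalancedBicoloring white) (hT : A.IsMaximalTree ξ T) (he : e ∈ ξ.sides) :
    ∃ c₀ : S × ZMod 4 → ℤ, A.IsCocycle c₀ ∧
      |∑ x, (c₀ x : ℚ) * (A.weightFlow white w x : ℚ)| = 2 := by
  have hbe : ¬ A.IsBoundarySide e := by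
    obtain ⟨i, rfl | rfl⟩ := he
    · exact ξ.not_boundarySide i
    · exact A.isBoundarySide_glue.not.2 (ξ.not_boundarySide i)
  have hflow := hw.weightFlow_glue hwhite
  obtain ⟨c, h1, h2, h3⟩ := exists_flow_of_path T (hT.connected e.1 (A.glue e).1)
  have h4 := h3 (A.weightFlow white w) hflow fun x hx => by
    rw [weightFlow, if_neg (hT.not_boundarySide x hx), hw.tree_eq x hx]
    simp [SignedMonomial.expP]
  refine ⟨fun x => c x + (if x = e then 1 else 0) - if x = A.glue e then 1 else 0,
    ⟨fun x => ?_, fun s => ?_⟩, ?_⟩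
  · have e1 : A.glue x = A.glue e ↔ x = e := A.gluePerm.injective.eq_iff
    have e2 : A.glue x = e ↔ x = A.glue e :=
      ⟨fun h => by rw [← h, A.glue_glue], fun h => by rw [h, A.glue_glue]⟩
    simp only [h1, e1, e2]
    ring
  · rw [Finset.sum_sub_distrib, Finset.sum_add_distrib, h2, sum_single, sum_single]
    ring
  · have h5 : ∑ x, (c x + (if x = e then 1 else 0) - if x = A.glue e then 1 else 0) *
        A.weightFlow white w x = 2 * A.weightFlow white w e := by
      simp only [add_mul, sub_mul, Finset.sum_add_distrib, Finset.sum_sub_distrib, h4, ite_mul,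
        one_mul, zero_mul, Finset.sum_ite_eq', Finset.mem_univ, if_true, hflow]
      ring
    have h6 : |A.weightFlow white w e| = 1 := by
      have hp : SignedMonomial.p.expP = 1 := rfl
      rw [weightFlow, if_neg hbe, hw.edge_eq, hp]
      split_ifs <;> rfl
    have h7 : |∑ x, (c x + (if x = e then 1 else 0) - if x = A.glue e then 1 else 0) *
        A.weightFlow white w x| = 2 := by
      rw [h5, abs_mul, h6]
      rfl
    exact_mod_cast h7

end Weights

/-! ### Superpositions of two tilings -/

section Superposition

/-- The other square of the domino that covers `s`. -/
def partner (A : QuadSurface S) (t : S → ZMod 4) (s : S) : S := (A.glue (s, t s)).1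

theorem IsTiling.glue_eq {t : S → ZMod 4} (ht : A.IsTiling t) (s : S) :
    A.glue (s, t s) = (A.partner t s, t (A.partner t s)) :=
  Prod.ext rfl (ht s).2.symm

theorem IsTiling.partner_partner {t : S → ZMod 4} (ht : A.IsTiling t) (s : S) :
    A.partner t (A.partner t s) = s := by
  rw [partner, ← ht.glue_eq, A.glue_glue]

theorem IsTiling.glue_iff {t : S → ZMod 4} (ht : A.IsTiling t) (x : S × ZMod 4) :
    t (A.glue x).1 = (A.glue x).2 ↔ t x.1 = x.2 := by
  have key : ∀ x : S × ZMod 4, t x.1 = x.2 → t (A.glue x).1 = (A.glue x).2 := by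
    rintro ⟨s, i⟩ h
    obtain rfl : t s = i := h
    exact (ht s).2
  exact ⟨fun h => by simpa only [A.glue_glue] using key _ h, key x⟩

/-- Two squares are linked if they belong to the same component (a closed curve or a common domino)
of the superposition of the tilings `t₁` and `t₂`. -/
def Linked (A : QuadSurface S) (t₁ t₂ : S → ZMod 4) : S → S → Prop :=
  Relation.EqvGen fun a b => b = A.partner t₁ a ∨ b = A.partner t₂ a

theorem linked_partner_left (t₁ t₂ : S → ZMod 4) (s : S) : A.Linked t₁ t₂ s (A.partner t₁ s) :=
  .rel _ _ (Or.inl rfl)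

theorem linked_partner_right (t₁ t₂ : S → ZMod 4) (s : S) : A.Linked t₁ t₂ s (A.partner t₂ s) :=
  .rel _ _ (Or.inr rfl)

variable [DecidableEq S]

/-- `K` is a union of components of the superposition. -/
def IsLinkClosed (A : QuadSurface S) (t₁ t₂ : S → ZMod 4) (K : Finset S) : Prop :=
  ∀ a b, A.Linked t₁ t₂ a b → (a ∈ K ↔ b ∈ K)

/-- The contribution of the squares in `K` to the difference of the fluxes of `t₂` and `t₁`. -/
def fluxDiff (white : Finset S) (w : S × ZMod 4 → SignedMonomial) (t₁ t₂ : S → ZMod 4)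
    (K : Finset S) : ℤ :=
  ∑ s ∈ white, if s ∈ K then (w (s, t₂ s)).expP - (w (s, t₁ s)).expP else 0

/-- The superposition of `t₁` and `t₂` within `K`, directed so that the dominoes of `t₂` run from
white to black squares and those of `t₁` from black to white squares. -/
def superposition (white : Finset S) (t₁ t₂ : S → ZMod 4) (K : Finset S) (x : S × ZMod 4) : ℤ :=
  if x.1 ∈ K then (if x.1 ∈ white then 1 else -1) *
    ((if t₂ x.1 = x.2 then 1 else 0) - if t₁ x.1 = x.2 then 1 else 0) else 0

variable {white : Finset S} {t₁ t₂ : S → ZMod 4} {K : Finset S}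

theorem superposition_of_isBoundarySide (h₁ : A.IsTiling t₁) (h₂ : A.IsTiling t₂)
    {x : S × ZMod 4} (hx : A.IsBoundarySide x) : superposition white t₁ t₂ K x = 0 := by
  obtain ⟨s, i⟩ := x
  have e1 : t₁ s ≠ i := by
    rintro rfl
    exact (h₁ s).1 hx
  have e2 : t₂ s ≠ i := by
    rintro rfl
    exact (h₂ s).1 hx
  simp [superposition, e1, e2]

theorem isCocycle_superposition [Fintype S] (hwhite : A.IsBalancedBicoloring white)
    (h₁ : A.IsTiling t₁) (h₂ : A.IsTiling t₂) (hK : A.IsLinkClosed t₁ t₂ K) :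
    A.IsCocycle (superposition white t₁ t₂ K) where
  glue x := by
    by_cases hb : A.IsBoundarySide x
    · rw [superposition_of_isBoundarySide h₁ h₂ hb,
        superposition_of_isBoundarySide h₁ h₂ (A.isBoundarySide_glue.2 hb), neg_zero]
    · have hw := hwhite.alternating x hb
      have hmem : (t₁ x.1 = x.2 ∨ t₂ x.1 = x.2) → ((A.glue x).1 ∈ K ↔ x.1 ∈ K) := by
        obtain ⟨s, i⟩ := x
        rintro (h | h)
        · obtain rfl : t₁ s = i := h
          exact (hK _ _ (linked_partner_left t₁ t₂ s)).symm
        · obtain rfl : t₂ s = i := h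
          exact (hK _ _ (linked_partner_right t₁ t₂ s)).symm
      simp only [superposition, h₁.glue_iff, h₂.glue_iff]
      by_cases hc : t₁ x.1 = x.2 ∨ t₂ x.1 = x.2
      · simp only [hmem hc]
        by_cases hwx : x.1 ∈ white
        · rw [if_pos hwx, if_neg (hw.1 hwx)]
          split_ifs <;> simp
        · rw [if_neg hwx, if_pos (not_not.1 (hw.not.1 hwx))]
          split_ifs <;> simp
      · push Not at hc
        simp [hc.1, hc.2]
  sum_eq_zero s := by
    simp only [superposition]
    split_ifs <;> simp

/-- The flux of a superposition; the factor `2` occurs because each domino is counted from both of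
its squares. -/
theorem sum_superposition_mul [Fintype S] {w : S × ZMod 4 → SignedMonomial}
    {ξ : A.Cut} {T : Set (S × ZMod 4)} {e : S × ZMod 4} (hw : A.IsKasteleynWeight white ξ T e w)
    (hwhite : A.IsBalancedBicoloring white)
    (h₁ : A.IsTiling t₁) (h₂ : A.IsTiling t₂) (hK : A.IsLinkClosed t₁ t₂ K) :
    ∑ x, superposition white t₁ t₂ K x * A.weightFlow white w x =
      2 * fluxDiff white w t₁ t₂ K := by
  set G : S × ZMod 4 → ℤ := fun x => superposition white t₁ t₂ K x * A.weightFlow white w x with hG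
  have hglue : ∀ x, G (A.glue x) = G x := fun x => by
    simp only [hG]
    rw [(isCocycle_superposition hwhite h₁ h₂ hK).glue, hw.weightFlow_glue hwhite, neg_mul_neg]
  have hsplit : ∑ x, G x = 2 * ∑ x : S × ZMod 4, if x.1 ∈ white then G x else 0 := by
    have e1 : ∑ x : S × ZMod 4, (if x.1 ∈ white then 0 else G x) =
        ∑ x : S × ZMod 4, if x.1 ∈ white then G x else 0 := by
      rw [← Equiv.sum_comp A.gluePerm]
      refine Finset.sum_congr rfl fun x _ => ?_
      rw [gluePerm_apply, hglue]
      by_cases hb : A.IsBoundarySide x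
      · simp [hG, superposition_of_isBoundarySide h₁ h₂ hb]
      · have := hwhite.alternating x hb
        by_cases hx : x.1 ∈ white
        · rw [if_pos hx, if_neg (this.1 hx)]
        · rw [if_neg hx, if_pos (not_not.1 (this.not.1 hx))]
    rw [two_mul]
    nth_rw 1 [← e1]
    rw [← Finset.sum_add_distrib]
    exact Finset.sum_congr rfl fun x _ => by split_ifs <;> simp
  rw [hsplit, Fintype.sum_prod_type, fluxDiff, ← Finset.sum_filter_add_sum_filter_not Finset.univ
    (· ∈ white), Finset.filter_univ_mem]
  congr 1
  rw [Finset.sum_eq_zero (s := Finset.univ.filter (· ∉ white)), add_zero]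
  · refine Finset.sum_congr rfl fun s hs => ?_
    simp only [hG, superposition, hs, if_true]
    by_cases hsK : s ∈ K
    · simp only [hsK, if_true, one_mul, sub_mul, ite_mul, zero_mul, Finset.sum_sub_distrib,
        Finset.sum_ite_eq, Finset.mem_univ, weightFlow, if_neg (h₁ s).1, if_neg (h₂ s).1, hs]
    · simp [hsK]
  · intro s hs
    simp [(Finset.mem_filter.1 hs).2]

/-- Going around a square, a function that steps up after `b` and down after `a` has equal values
just after `a` and at `b`. -/
theorem eq_of_step (g : ZMod 4 → ℚ) (a b : ZMod 4)
    (h : ∀ i, g (i + 1) = g i + ((if b = i then 1 else 0) - if a = i then 1 else 0)) :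
    g (a + 1) = g b := by
  have hb : b = a ∨ b = a + 1 ∨ b = a + 1 + 1 ∨ b = a + 1 + 1 + 1 := by
    clear h
    revert a b; decide
  have n1 : a ≠ a + 1 := by clear h hb; revert a; decide
  have n2 : a ≠ a + 1 + 1 := by clear h hb n1; revert a; decide
  have n3 : a + 1 + 1 ≠ a + 1 := by clear h hb n1 n2; revert a; decide
  have n4 : a + 1 + 1 + 1 ≠ a + 1 := by clear h hb n1 n2 n3; revert a; decide
  have n5 : a + 1 + 1 + 1 ≠ a + 1 + 1 := by clear h hb n1 n2 n3 n4; revert a; decide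
  rcases hb with rfl | rfl | rfl | rfl
  · rw [h]; simp
  · rfl
  · rw [h (a + 1), if_neg n3, if_neg n1]; ring
  · rw [h (a + 1 + 1), h (a + 1), if_neg n5, if_neg n2, if_neg n4, if_neg n1]; ring

/-- A potential of a superposition is constant on the side of each component where it is lower. -/
theorem potential_eq_of_linked [Fintype S] (hwhite : A.IsBalancedBicoloring white)
    (h₁ : A.IsTiling t₁) (h₂ : A.IsTiling t₂) (hK : A.IsLinkClosed t₁ t₂ K)
    {h : S × ZMod 4 → ℚ} (hp : A.IsPotential (superposition white t₁ t₂ K) h) {a b : S}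
    (hab : A.Linked t₁ t₂ a b) (ha : a ∈ K) :
    (if a ∈ white then h (a, t₂ a) else h (a, t₁ a)) =
      if b ∈ white then h (b, t₂ b) else h (b, t₁ b) := by
  -- Along the boundary of a square, the potential changes only at the two sides that are crossed.
  have hstep : ∀ s i, h (s, i + 1) = h (s, i) + superposition white t₁ t₂ K (s, i) := by
    intro s i
    have h1 := hp.next (s, i)
    have h2 := hp.eq_sub (s, i)
    rw [← h1] at h2
    rw [h2]
    simp [next]
  have hcorner : ∀ s ∈ K, (s ∈ white → h (s, t₁ s + 1) = h (s, t₂ s)) ∧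
      (s ∉ white → h (s, t₂ s + 1) = h (s, t₁ s)) := by
    intro s hs
    constructor
    · intro hsw
      exact eq_of_step (fun i => h (s, i)) (t₁ s) (t₂ s) fun i => by
        rw [hstep]; simp [superposition, hs, hsw]
    · intro hsw
      exact eq_of_step (fun i => h (s, i)) (t₂ s) (t₁ s) fun i => by
        rw [hstep]; simp [superposition, hs, hsw]
  have hcross : ∀ t, A.IsTiling t → ∀ s, h (A.partner t s, t (A.partner t s)) = h (s, t s + 1) :=
    fun t ht s => by rw [← ht.glue_eq, ← hp.next]; rfl
  have hcolor : ∀ t, A.IsTiling t → ∀ s, s ∈ white ↔ A.partner t s ∉ white :=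
    fun t ht s => hwhite.alternating _ (ht s).1
  revert ha
  induction hab with
  | rel a b hab =>
    intro ha
    have hb := (hK a b (.rel a b hab)).1 ha
    rcases hab with rfl | rfl
    · have hcol := hcolor t₁ h₁ a
      have e1 := hcross t₁ h₁ a
      have e2 := hcross t₁ h₁ (A.partner t₁ a)
      rw [h₁.partner_partner] at e2
      by_cases haw : a ∈ white
      · rw [if_pos haw, if_neg (hcol.1 haw), e1, (hcorner a ha).1 haw]
      · have hbw := not_not.1 (hcol.not.1 haw)
        rw [if_neg haw, if_pos hbw, e2, (hcorner _ hb).1 hbw]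
    · have hcol := hcolor t₂ h₂ a
      have e1 := hcross t₂ h₂ a
      have e2 := hcross t₂ h₂ (A.partner t₂ a)
      rw [h₂.partner_partner] at e2
      by_cases haw : a ∈ white
      · rw [if_pos haw, if_neg (hcol.1 haw), e2, (hcorner _ hb).2 (hcol.1 haw)]
      · rw [if_neg haw, if_pos (not_not.1 (hcol.not.1 haw)), e1, (hcorner a ha).2 haw]
  | refl => exact fun _ => rfl
  | symm a b hab ih => exact fun hb => (ih ((hK a b hab).2 hb)).symm
  | trans a b c hab _ ih₁ ih₂ => exact fun ha => (ih₁ ha).trans (ih₂ ((hK a b hab).1 ha))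

/-- A component of the superposition of two tilings changes the flux by at most one: a simple closed
curve goes around the annulus at most once. -/
theorem IsKasteleynWeight.abs_fluxDiff_le [Fintype S] {w : S × ZMod 4 → SignedMonomial}
    {ξ : A.Cut} {T : Set (S × ZMod 4)} {e : S × ZMod 4} (hw : A.IsKasteleynWeight white ξ T e w)
    (hA : A.IsAnnulus) (hwhite : A.IsBalancedBicoloring white) (hT : A.IsMaximalTree ξ T)
    (he : e ∈ ξ.sides) (h₁ : A.IsTiling t₁) (h₂ : A.IsTiling t₂) {s₀ : S}
    (hK : ∀ s, s ∈ K ↔ A.Linked t₁ t₂ s₀ s) : |fluxDiff white w t₁ t₂ K| ≤ 1 := by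
  have hclosed : A.IsLinkClosed t₁ t₂ K := fun a b hab => by
    rw [hK, hK]
    exact ⟨fun h => h.trans _ _ _ hab, fun h => h.trans _ _ _ (hab.symm _ _)⟩
  have hc := isCocycle_superposition hwhite h₁ h₂ hclosed
  obtain ⟨h, hp⟩ := hA.exists_isPotential hc
  obtain ⟨c₀, hc₀, h₀⟩ := hw.exists_isCocycle hwhite hT he
  have hs₀ : s₀ ∈ K := (hK s₀).2 (.refl _)
  have hle := hA.abs_sum_mul_le hwhite (hw.isRelativeCycle hwhite) hc₀ h₀ hp
    (hA.abs_potential_sub_le hc.glue hp (k := if s₀ ∈ white then h (s₀, t₂ s₀) else h (s₀, t₁ s₀))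
      (fun x => by
        unfold superposition
        split_ifs <;> simp)
      (fun x hx => by
        obtain ⟨s, i⟩ := x
        have hsK : s ∈ K := by
          by_contra hsK
          simp [superposition, hsK] at hx
        rw [potential_eq_of_linked hwhite h₁ h₂ hclosed hp ((hK s).1 hsK) hs₀]
        by_cases hsw : s ∈ white
        · have : t₂ s = i := by
            by_contra hne
            simp only [superposition, hsK, hsw, hne, if_true, if_false] at hx
            split_ifs at hx
            all_goals simp at hx
          rw [if_pos hsw, this]
        · have : t₁ s = i := by
            by_contra hne
            simp only [superposition, hsK, hsw, hne, if_true, if_false] at hx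
            split_ifs at hx
            all_goals simp at hx
          rw [if_neg hsw, this]))
  have hsum := sum_superposition_mul hw hwhite h₁ h₂ hclosed
  have hle' : |∑ x, superposition white t₁ t₂ K x * A.weightFlow white w x| ≤ 2 := by
    exact_mod_cast hle
  rw [hsum, abs_mul, abs_two] at hle'
  linarith

end Superposition

/-! ### Exchange of dominoes -/

theorem volume_eq_sum (white : Finset S) (w : S × ZMod 4 → SignedMonomial) (t : S → ZMod 4) :
    volume white w t = ∑ s ∈ white, (w (s, t s)).expQ := by
  simp [volume, tilingWeight, SignedMonomial.expQ, Prod.snd_prod]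

theorem flux_eq_sum (white : Finset S) (w : S × ZMod 4 → SignedMonomial) (t : S → ZMod 4) :
    flux white w t = ∑ s ∈ white, (w (s, t s)).expP := by
  simp [flux, tilingWeight, SignedMonomial.expP, Prod.snd_prod, Prod.fst_prod]

theorem linked_comm (t₁ t₂ : S → ZMod 4) : A.Linked t₁ t₂ = A.Linked t₂ t₁ := by
  unfold Linked
  simp only [or_comm]

open Classical in
/-- The squares in the components that contain one of the first `j` squares, in a fixed enumeration
of the squares. The components of a superposition are thus listed in an order that does not depend
on which of its dominoes belong to which of the two tilings. -/
noncomputable def initialPart [Fintype S] (A : QuadSurface S) (t₁ t₂ : S → ZMod 4) (j : ℕ) :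
    Finset S :=
  Finset.univ.filter fun s => ∃ r, (Fintype.equivFin S r : ℕ) < j ∧ A.Linked t₁ t₂ r s

theorem mem_initialPart [Fintype S] {t₁ t₂ : S → ZMod 4} {j : ℕ} {s : S} :
    s ∈ A.initialPart t₁ t₂ j ↔
    ∃ r, (Fintype.equivFin S r : ℕ) < j ∧ A.Linked t₁ t₂ r s := by
  simp [initialPart]

theorem IsLinkClosed.symm {t₁ t₂ : S → ZMod 4} {K : Finset S}
    (hK : A.IsLinkClosed t₁ t₂ K) : A.IsLinkClosed t₂ t₁ K := by
  intro a b hab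
  rw [linked_comm] at hab
  exact hK a b hab

theorem isLinkClosed_initialPart [Fintype S] (t₁ t₂ : S → ZMod 4) (j : ℕ) :
    A.IsLinkClosed t₁ t₂ (A.initialPart t₁ t₂ j) := by
  intro a b hab
  simp only [mem_initialPart]
  exact ⟨fun ⟨r, hr, h⟩ => ⟨r, hr, h.trans _ _ _ hab⟩,
    fun ⟨r, hr, h⟩ => ⟨r, hr, h.trans _ _ _ (hab.symm _ _)⟩⟩

theorem initialPart_mono [Fintype S] (t₁ t₂ : S → ZMod 4) : Monotone (A.initialPart t₁ t₂) := by
  intro i j hij s hs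
  obtain ⟨r, hr, h⟩ := mem_initialPart.1 hs
  exact mem_initialPart.2 ⟨r, hr.trans_le hij, h⟩

theorem initialPart_card [Fintype S] (t₁ t₂ : S → ZMod 4) :
    A.initialPart t₁ t₂ (Fintype.card S) = Finset.univ :=
  Finset.eq_univ_of_forall fun s => mem_initialPart.2 ⟨s, Fin.isLt _, .refl s⟩

section Exchange

variable [DecidableEq S] {white : Finset S} {w : S × ZMod 4 → SignedMonomial}
  {t₁ t₂ : S → ZMod 4} {K : Finset S}

theorem IsLinkClosed.isTiling_piecewise (hK : A.IsLinkClosed t₁ t₂ K) (h₁ : A.IsTiling t₁)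
    (h₂ : A.IsTiling t₂) : A.IsTiling (K.piecewise t₁ t₂) := by
  intro s
  by_cases hs : s ∈ K
  · rw [K.piecewise_eq_of_mem _ _ hs]
    refine ⟨(h₁ s).1, ?_⟩
    change K.piecewise t₁ t₂ (A.partner t₁ s) = _
    rw [K.piecewise_eq_of_mem _ _ ((hK _ _ (linked_partner_left t₁ t₂ s)).1 hs)]
    exact (h₁ s).2
  · rw [K.piecewise_eq_of_notMem _ _ hs]
    refine ⟨(h₂ s).1, ?_⟩
    change K.piecewise t₁ t₂ (A.partner t₂ s) = _
    rw [K.piecewise_eq_of_notMem _ _ ((hK _ _ (linked_partner_right t₁ t₂ s)).not.1 hs)]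
    exact (h₂ s).2

/-- Exchanging dominoes does not change the components of the superposition. -/
theorem linked_piecewise (t₁ t₂ : S → ZMod 4) (K : Finset S) :
    A.Linked (K.piecewise t₁ t₂) (K.piecewise t₂ t₁) = A.Linked t₁ t₂ := by
  unfold Linked
  congr 1
  ext a b
  by_cases ha : a ∈ K
  · simp [partner, ha]
  · simp [partner, ha, or_comm]

theorem flux_piecewise (white : Finset S) (w : S × ZMod 4 → SignedMonomial)
    (t₁ t₂ : S → ZMod 4) (K : Finset S) :
    flux white w (K.piecewise t₁ t₂) = flux white w t₂ - fluxDiff white w t₁ t₂ K := by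
  rw [flux_eq_sum, flux_eq_sum, fluxDiff, ← Finset.sum_sub_distrib]
  refine Finset.sum_congr rfl fun s _ => ?_
  by_cases hs : s ∈ K <;> simp [hs]

theorem flux_piecewise' (white : Finset S) (w : S × ZMod 4 → SignedMonomial)
    (t₁ t₂ : S → ZMod 4) (K : Finset S) :
    flux white w (K.piecewise t₂ t₁) = flux white w t₁ + fluxDiff white w t₁ t₂ K := by
  rw [flux_eq_sum, flux_eq_sum, fluxDiff, ← Finset.sum_add_distrib]
  refine Finset.sum_congr rfl fun s _ => ?_
  by_cases hs : s ∈ K <;> simp [hs]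

theorem volume_piecewise_add (white : Finset S) (w : S × ZMod 4 → SignedMonomial)
    (t₁ t₂ : S → ZMod 4) (K : Finset S) :
    volume white w (K.piecewise t₁ t₂) + volume white w (K.piecewise t₂ t₁) =
      volume white w t₁ + volume white w t₂ := by
  simp only [volume_eq_sum, ← Finset.sum_add_distrib]
  refine Finset.sum_congr rfl fun s _ => ?_
  by_cases hs : s ∈ K <;> simp [hs, add_comm]

variable [Fintype S]

theorem fluxDiff_initialPart_zero (t₁ t₂ : S → ZMod 4) :
    fluxDiff white w t₁ t₂ (A.initialPart t₁ t₂ 0) = 0 := by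
  simp [fluxDiff, mem_initialPart]

theorem fluxDiff_initialPart_card (t₁ t₂ : S → ZMod 4) :
    fluxDiff white w t₁ t₂ (A.initialPart t₁ t₂ (Fintype.card S)) =
      flux white w t₂ - flux white w t₁ := by
  simp [fluxDiff, initialPart_card, flux_eq_sum]

/-- Passing from one initial part to the next adds at most one component. -/
theorem IsKasteleynWeight.abs_fluxDiff_initialPart_succ_sub_le {ξ : A.Cut} {T : Set (S × ZMod 4)}
    {e : S × ZMod 4} (hw : A.IsKasteleynWeight white ξ T e w)
    (hA : A.IsAnnulus) (hwhite : A.IsBalancedBicoloring white) (hT : A.IsMaximalTree ξ T)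
    (he : e ∈ ξ.sides) (h₁ : A.IsTiling t₁) (h₂ : A.IsTiling t₂) (j : ℕ) :
    |fluxDiff white w t₁ t₂ (A.initialPart t₁ t₂ (j + 1)) -
      fluxDiff white w t₁ t₂ (A.initialPart t₁ t₂ j)| ≤ 1 := by
  classical
  by_cases hsame : A.initialPart t₁ t₂ (j + 1) = A.initialPart t₁ t₂ j
  · simp [hsame]
  obtain ⟨s, hs, hs'⟩ : ∃ s ∈ A.initialPart t₁ t₂ (j + 1), s ∉ A.initialPart t₁ t₂ j := by
    by_contra! hall
    exact hsame (Finset.Subset.antisymm hall (initialPart_mono t₁ t₂ j.le_succ))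
  have hnew : ∀ u, A.Linked t₁ t₂ s u ↔
      u ∈ A.initialPart t₁ t₂ (j + 1) ∧ u ∉ A.initialPart t₁ t₂ j := by
    intro u
    constructor
    · intro hu
      exact ⟨(isLinkClosed_initialPart t₁ t₂ _ s u hu).1 hs,
        (isLinkClosed_initialPart t₁ t₂ _ s u hu).not.1 hs'⟩
    · rintro ⟨hu, hu'⟩
      obtain ⟨r, hr, hrs⟩ := mem_initialPart.1 hs
      obtain ⟨r', hr', hru⟩ := mem_initialPart.1 hu
      have e1 : ¬ (Fintype.equivFin S r : ℕ) < j := fun h => hs' (mem_initialPart.2 ⟨r, h, hrs⟩)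
      have e2 : ¬ (Fintype.equivFin S r' : ℕ) < j := fun h => hu' (mem_initialPart.2 ⟨r', h, hru⟩)
      obtain rfl : r = r' := (Fintype.equivFin S).injective (Fin.ext (by omega))
      exact (hrs.symm _ _).trans _ _ _ hru
  have hcomp := hw.abs_fluxDiff_le hA hwhite hT he h₁ h₂ (s₀ := s)
    (K := A.initialPart t₁ t₂ (j + 1) \ A.initialPart t₁ t₂ j)
    (fun u => by rw [Finset.mem_sdiff, hnew])
  convert hcomp using 2
  simp only [fluxDiff]
  rw [← Finset.sum_sub_distrib]
  refine Finset.sum_congr rfl fun u _ => ?_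
  by_cases hu : u ∈ A.initialPart t₁ t₂ j
  · simp [hu, initialPart_mono t₁ t₂ j.le_succ hu]
  · simp [hu]

theorem exists_eq_of_step_le_one {F : ℕ → ℤ} (hF : ∀ j, |F (j + 1) - F j| ≤ 1) {v : ℤ} (n : ℕ)
    (h0 : F 0 ≤ v) (hn : v ≤ F n) : ∃ j, F j = v := by
  induction n with
  | zero => exact ⟨0, le_antisymm h0 hn⟩
  | succ n ih =>
    by_cases h : v ≤ F n
    · exact ih h
    · have := abs_le.1 (hF n)
      exact ⟨n + 1, by omega⟩

theorem IsKasteleynWeight.exists_fluxDiff_initialPart_eq {ξ : A.Cut} {T : Set (S × ZMod 4)}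
    {e : S × ZMod 4} (hw : A.IsKasteleynWeight white ξ T e w)
    (hA : A.IsAnnulus) (hwhite : A.IsBalancedBicoloring white) (hT : A.IsMaximalTree ξ T)
    (he : e ∈ ξ.sides) (h₁ : A.IsTiling t₁) (h₂ : A.IsTiling t₂) {v : ℤ} (h0 : 0 ≤ v)
    (hv : v ≤ flux white w t₂ - flux white w t₁) :
    ∃ j, fluxDiff white w t₁ t₂ (A.initialPart t₁ t₂ j) = v :=
  exists_eq_of_step_le_one
    (F := fun j => fluxDiff white w t₁ t₂ (A.initialPart t₁ t₂ j))
    (fun j => hw.abs_fluxDiff_initialPart_succ_sub_le hA hwhite hT he h₁ h₂ j)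
    (Fintype.card S) (by simpa only [fluxDiff_initialPart_zero] using h0)
    (by simpa only [fluxDiff_initialPart_card] using hv)

/-- The first initial part on which `t₂` has one unit of flux more than `t₁`. -/
noncomputable def firstUnitPart (A : QuadSurface S) (white : Finset S)
    (w : S × ZMod 4 → SignedMonomial) (t₁ t₂ : S → ZMod 4) : Finset S :=
  A.initialPart t₁ t₂ (sInf {j | fluxDiff white w t₁ t₂ (A.initialPart t₁ t₂ j) = 1})

theorem fluxDiff_firstUnitPart
    (h : ∃ j, fluxDiff white w t₁ t₂ (A.initialPart t₁ t₂ j) = 1) :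
    fluxDiff white w t₁ t₂ (A.firstUnitPart white w t₁ t₂) = 1 :=
  Nat.sInf_mem h

/-- Two tilings exchange their dominoes outside the first initial part with flux difference one. -/
noncomputable def exchange (A : QuadSurface S) (white : Finset S)
    (w : S × ZMod 4 → SignedMonomial) (t : (S → ZMod 4) × (S → ZMod 4)) :
    (S → ZMod 4) × (S → ZMod 4) :=
  ((A.firstUnitPart white w t.1 t.2).piecewise t.1 t.2,
    (A.firstUnitPart white w t.1 t.2).piecewise t.2 t.1)

theorem firstUnitPart_exchange
    (h : ∃ j, fluxDiff white w t₁ t₂ (A.initialPart t₁ t₂ j) = 1) :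
    A.firstUnitPart white w (A.exchange white w (t₁, t₂)).1 (A.exchange white w (t₁, t₂)).2 =
      A.firstUnitPart white w t₁ t₂ := by
  set K := A.firstUnitPart white w t₁ t₂ with hK
  set m := sInf {j | fluxDiff white w t₁ t₂ (A.initialPart t₁ t₂ j) = 1} with hm
  have hpart : ∀ j, A.initialPart (K.piecewise t₁ t₂) (K.piecewise t₂ t₁) j =
      A.initialPart t₁ t₂ j := fun j => by
    ext s
    rw [mem_initialPart, mem_initialPart, linked_piecewise]
  -- Up to the index `m` of `K`, the initial parts lie in `K`, where nothing is exchanged.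
  have hdiff : ∀ j ≤ m, fluxDiff white w (K.piecewise t₁ t₂) (K.piecewise t₂ t₁)
      (A.initialPart t₁ t₂ j) = fluxDiff white w t₁ t₂ (A.initialPart t₁ t₂ j) := by
    intro j hj
    refine Finset.sum_congr rfl fun s _ => ?_
    by_cases hs : s ∈ A.initialPart t₁ t₂ j
    · have hsK : s ∈ K := initialPart_mono t₁ t₂ hj hs
      simp [hs, hsK]
    · simp [hs]
  have hmem : fluxDiff white w t₁ t₂ (A.initialPart t₁ t₂ m) = 1 := Nat.sInf_mem h
  have hmin : sInf {j | fluxDiff white w (K.piecewise t₁ t₂) (K.piecewise t₂ t₁)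
      (A.initialPart t₁ t₂ j) = 1} = m := by
    have hmem' : m ∈ {j | fluxDiff white w (K.piecewise t₁ t₂) (K.piecewise t₂ t₁)
        (A.initialPart t₁ t₂ j) = 1} := (hdiff m le_rfl).trans hmem
    refine le_antisymm (Nat.sInf_le hmem') (Nat.sInf_le ?_)
    have h' := Nat.sInf_mem ⟨m, hmem'⟩
    exact (hdiff _ (Nat.sInf_le hmem')).symm.trans h'
  change A.initialPart (K.piecewise t₁ t₂) (K.piecewise t₂ t₁)
    (sInf {j | fluxDiff white w (K.piecewise t₁ t₂) (K.piecewise t₂ t₁)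
      (A.initialPart (K.piecewise t₁ t₂) (K.piecewise t₂ t₁) j) = 1}) = K
  simp only [hpart, hmin]
  rfl

theorem exchange_exchange
    (h : ∃ j, fluxDiff white w t₁ t₂ (A.initialPart t₁ t₂ j) = 1) :
    A.exchange white w (A.exchange white w (t₁, t₂)) = (t₁, t₂) := by
  have hK := firstUnitPart_exchange h
  unfold exchange at hK ⊢
  simp only at hK ⊢
  rw [hK]
  set K := A.firstUnitPart white w t₁ t₂
  ext s <;> by_cases hs : s ∈ K <;> simp [hs]

end Exchange

/-! ### The coefficients of the `q`-flux polynomial -/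

section Coefficients

variable [Fintype S] {white : Finset S} {w : S × ZMod 4 → SignedMonomial}

theorem mem_tilings {t : S → ZMod 4} : t ∈ A.tilings ↔ A.IsTiling t := by
  simp [tilings]

theorem coeff_qFluxPolynomial (q : ℝ) (f : ℤ) :
    (A.qFluxPolynomial white w q).coeff f =
      ∑ t ∈ A.tilings with flux white w t = f, q ^ volume white w t := by
  simp only [qFluxPolynomial, ← LaurentPolynomial.single_eq_C_mul_T, AddMonoidAlgebra.coeff_sum,
    AddMonoidAlgebra.coeff_single]
  rw [Finset.sum_apply', Finset.sum_filter]
  simp only [Finsupp.single_apply]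

theorem coeff_qFluxPolynomial_nonneg {q : ℝ} (hq : 0 < q) (f : ℤ) :
    0 ≤ (A.qFluxPolynomial white w q).coeff f := by
  rw [coeff_qFluxPolynomial]
  exact Finset.sum_nonneg fun t _ => (zpow_pos hq _).le

theorem coeff_qFluxPolynomial_ne_zero_iff {q : ℝ} (hq : 0 < q) (f : ℤ) :
    (A.qFluxPolynomial white w q).coeff f ≠ 0 ↔ ∃ t, A.IsTiling t ∧ flux white w t = f := by
  rw [coeff_qFluxPolynomial, Ne, Finset.sum_eq_zero_iff_of_nonneg fun t _ => (zpow_pos hq _).le]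
  simp only [Finset.mem_filter, mem_tilings, (zpow_pos hq _).ne']
  simp

theorem sum_le_sum_of_injOn_of_comp_eq {α : Type*} {s t : Finset α} {g : α → ℝ} (hg : ∀ x, 0 ≤ g x)
    (φ : α → α) (hmaps : ∀ x ∈ s, φ x ∈ t) (hinj : Set.InjOn φ s) (hφ : ∀ x, g (φ x) = g x) :
    ∑ x ∈ s, g x ≤ ∑ x ∈ t, g x := by
  classical
  calc ∑ x ∈ s, g x = ∑ x ∈ s.image φ, g x := by
        rw [Finset.sum_image hinj]
        exact Finset.sum_congr rfl fun x _ => (hφ x).symm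
    _ ≤ ∑ x ∈ t, g x :=
        Finset.sum_le_sum_of_subset_of_nonneg (Finset.image_subset_iff.2 hmaps) fun x _ _ => hg x

variable [DecidableEq S] {ξ : A.Cut} {T : Set (S × ZMod 4)} {e : S × ZMod 4}

/-- Exchanging dominoes embeds the pairs of tilings with fluxes `f - 1`, `f + 1` into the pairs of
tilings with flux `f`, and preserves the total volume. -/
theorem IsKasteleynWeight.coeff_mul_coeff_le (hw : A.IsKasteleynWeight white ξ T e w)
    (hA : A.IsAnnulus) (hwhite : A.IsBalancedBicoloring white) (hT : A.IsMaximalTree ξ T)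
    (he : e ∈ ξ.sides) {q : ℝ} (hq : 0 < q) (f : ℤ) :
    (A.qFluxPolynomial white w q).coeff (f - 1) * (A.qFluxPolynomial white w q).coeff (f + 1) ≤
      (A.qFluxPolynomial white w q).coeff f ^ 2 := by
  simp only [coeff_qFluxPolynomial, sq]
  rw [Finset.sum_mul_sum, Finset.sum_mul_sum, ← Finset.sum_product', ← Finset.sum_product']
  have hex : ∀ t₁ t₂, A.IsTiling t₁ → flux white w t₁ = f - 1 → A.IsTiling t₂ →
      flux white w t₂ = f + 1 → ∃ j, fluxDiff white w t₁ t₂ (A.initialPart t₁ t₂ j) = 1 :=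
    fun t₁ t₂ h₁ f₁ h₂ f₂ =>
      hw.exists_fluxDiff_initialPart_eq hA hwhite hT he h₁ h₂ zero_le_one (by omega)
  refine sum_le_sum_of_injOn_of_comp_eq
    (fun t => (mul_pos (zpow_pos hq _) (zpow_pos hq _)).le) (A.exchange white w) ?_ ?_ ?_
  · rintro ⟨t₁, t₂⟩ ht
    simp only [Finset.mem_product, Finset.mem_filter, mem_tilings] at ht
    obtain ⟨⟨h₁, f₁⟩, h₂, f₂⟩ := ht
    have hone := fluxDiff_firstUnitPart (hex t₁ t₂ h₁ f₁ h₂ f₂)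
    have hclosed : A.IsLinkClosed t₁ t₂ (A.firstUnitPart white w t₁ t₂) :=
      isLinkClosed_initialPart _ _ _
    simp only [exchange, Finset.mem_product, Finset.mem_filter, mem_tilings]
    rw [flux_piecewise white w t₁ t₂, flux_piecewise' white w t₁ t₂, hone]
    exact ⟨⟨hclosed.isTiling_piecewise h₁ h₂, by omega⟩,
      hclosed.symm.isTiling_piecewise h₂ h₁, by omega⟩
  · refine Set.LeftInvOn.injOn (f₁' := A.exchange white w) ?_
    rintro ⟨t₁, t₂⟩ ht
    simp only [Finset.mem_coe, Finset.mem_product, Finset.mem_filter, mem_tilings] at ht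
    exact exchange_exchange (hex t₁ t₂ ht.1.1 ht.1.2 ht.2.1 ht.2.2)
  · intro t
    rw [← zpow_add₀ hq.ne', ← zpow_add₀ hq.ne', exchange, volume_piecewise_add]

theorem IsKasteleynWeight.exists_isTiling_flux_eq (hw : A.IsKasteleynWeight white ξ T e w)
    (hA : A.IsAnnulus) (hwhite : A.IsBalancedBicoloring white) (hT : A.IsMaximalTree ξ T)
    (he : e ∈ ξ.sides) {t₁ t₂ : S → ZMod 4} (h₁ : A.IsTiling t₁) (h₂ : A.IsTiling t₂) {f : ℤ}
    (hf₁ : flux white w t₁ ≤ f) (hf₂ : f ≤ flux white w t₂) :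
    ∃ t, A.IsTiling t ∧ flux white w t = f := by
  obtain ⟨j, hj⟩ := hw.exists_fluxDiff_initialPart_eq hA hwhite hT he h₁ h₂
    (v := f - flux white w t₁) (by omega) (by omega)
  exact ⟨_, (isLinkClosed_initialPart t₁ t₂ j).symm.isTiling_piecewise h₂ h₁, by
    rw [flux_piecewise', hj]; ring⟩

end Coefficients

end QuadSurface

/-! ### Log-concave sequences -/

/-- To the right of a maximum, a log-concave sequence without internal zeros decreases: a first
ascent would force an ascent at the step before. -/
theorem IsLogConcaveSeq.succ_le {a : ℤ → ℝ} (ha : IsLogConcaveSeq a)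
    (hint : ∀ i j k, i ≤ j → j ≤ k → a i ≠ 0 → a k ≠ 0 → a j ≠ 0) {m : ℤ} (hm : a m ≠ 0)
    (hmax : ∀ k, a k ≤ a m) (n : ℕ) : a (m + n + 1) ≤ a (m + n) := by
  induction n with
  | zero => simpa using hmax (m + 1)
  | succ n ih =>
    by_contra! hlt
    push_cast at hlt
    have h0 := ha.1 (m + (n + 1))
    have hpos : 0 < a (m + (n + 1)) := lt_of_le_of_ne h0
      (hint m _ (m + (n + 1) + 1) (by omega) (by omega) hm (h0.trans_lt hlt).ne').symm
    have hlc := ha.2 (m + (n + 1))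
    rw [show m + ((n : ℤ) + 1) - 1 = m + n by ring] at hlc
    rw [show m + (n : ℤ) + 1 = m + (n + 1) by ring] at ih
    nlinarith

/-- A log-concave sequence of finite support without internal zeros is unimodal. -/
theorem IsLogConcaveSeq.isUnimodalSeq {a : ℤ → ℝ} (ha : IsLogConcaveSeq a)
    (hfin : a.support.Finite) (hint : ∀ i j k, i ≤ j → j ≤ k → a i ≠ 0 → a k ≠ 0 → a j ≠ 0) :
    IsUnimodalSeq a := by
  by_cases hne : a.support.Nonempty
  · obtain ⟨m, hm, hmax⟩ := hfin.exists_maximalFor a _ hne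
    have hmax' : ∀ k, a k ≤ a m := fun k => by
      by_cases hk : a k = 0
      · rw [hk]
        exact ha.1 m
      · exact (le_total (a k) (a m)).elim id (hmax hk)
    refine ⟨m, ?_, ?_⟩
    · -- The reversed sequence is decreasing to the right of `-m`.
      have hrev : IsLogConcaveSeq fun k => a (-k) := ⟨fun k => ha.1 _, fun k => by
        have := ha.2 (-k)
        rwa [mul_comm, show -k - 1 = -(k + 1) by ring, show -k + 1 = -(k - 1) by ring] at this⟩
      have hstep := hrev.succ_le (m := -m)
        (fun i j k hij hjk hi hk => hint _ _ _ (neg_le_neg hjk) (neg_le_neg hij) hk hi)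
        (by simpa using hm) (fun k => by simpa using hmax' (-k))
      have hanti : Antitone fun n : ℕ => a (-(-m + n)) := antitone_nat_of_succ_le fun n => by
        have := hstep n
        push_cast
        rwa [add_assoc] at this
      intro i hi j hj hij
      simp only [Set.mem_Iic] at hi hj
      have := hanti (show (m - j).toNat ≤ (m - i).toNat by omega)
      simp only [Int.toNat_of_nonneg (sub_nonneg.2 hi), Int.toNat_of_nonneg (sub_nonneg.2 hj)]
        at this
      simpa using this
    · have hanti : Antitone fun n : ℕ => a (m + n) := antitone_nat_of_succ_le fun n => by
        have := ha.succ_le hint hm hmax' n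
        push_cast
        rwa [add_assoc] at this
      intro i hi j hj hij
      simp only [Set.mem_Ici] at hi hj
      have := hanti (show (i - m).toNat ≤ (j - m).toNat by omega)
      simp only [Int.toNat_of_nonneg (sub_nonneg.2 hi), Int.toNat_of_nonneg (sub_nonneg.2 hj)]
        at this
      simpa using this
  · rw [Set.not_nonempty_iff_eq_empty, Function.support_eq_empty_iff] at hne
    subst hne
    exact ⟨0, fun _ _ _ _ _ => le_rfl, fun _ _ _ _ _ => le_rfl⟩

theorem mainTheorem2 {S : Type*} [Fintype S] [DecidableEq S]
    (A : QuadSurface S) (hA : A.IsAnnulus)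
    (white : Finset S) (hwhite : A.IsBalancedBicoloring white)
    (ξ : A.Cut) (T : Set (S × ZMod 4)) (hT : A.IsMaximalTree ξ T)
    (e : S × ZMod 4) (he : e ∈ ξ.sides)
    (w : S × ZMod 4 → SignedMonomial) (hw : A.IsKasteleynWeight white ξ T e w)
    (q : ℝ) (hq : 0 < q) :
    IsLogConcaveSeq (fun f : ℤ => (A.qFluxPolynomial white w q).coeff f) ∧
      IsUnimodalSeq (fun f : ℤ => (A.qFluxPolynomial white w q).coeff f) := by
  have hlc : IsLogConcaveSeq fun f : ℤ => (A.qFluxPolynomial white w q).coeff f :=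
    ⟨fun f => QuadSurface.coeff_qFluxPolynomial_nonneg hq f,
      fun f => hw.coeff_mul_coeff_le hA hwhite hT he hq f⟩
  refine ⟨hlc, hlc.isUnimodalSeq (Finsupp.hasFiniteSupport _) fun i j k hij hjk hi hk => ?_⟩
  obtain ⟨t₁, h₁, rfl⟩ := (QuadSurface.coeff_qFluxPolynomial_ne_zero_iff hq i).1 hi
  obtain ⟨t₂, h₂, rfl⟩ := (QuadSurface.coeff_qFluxPolynomial_ne_zero_iff hq k).1 hk
  exact (QuadSurface.coeff_qFluxPolynomial_ne_zero_iff hq j).2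
    (hw.exists_isTiling_flux_eq hA hwhite hT he h₁ h₂ hij hjk)
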